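/- Let $G$ be a diffeological group and $X$ a diffeological space. Let $\mathsf{Cart}$ be the category of the spaces $\mathbb{R}^n$ ($n\ge 0$) and smooth maps, and let $\mathsf{Plot}(X)$ be the category whose objects are the plots $p\colon U_p\to X$ (with $U_p\in\mathsf{Cart}$) and whose morphisms $p\to q$ are the smooth maps $f\colon U_p\to U_q$ with $q\circ f=p$. Let $BG$ be the simplicial presheaf on $\mathsf{Cart}$ whose value at $U$ is the nerve of the one-object groupoid with automorphism group $C^\infty(U,G)$ (the composite of $h$ followed by $k$ being $kh$). Let $BG(QX)$ be the cosimplicial simplicial set $$BG(QX)^m=\prod_{p_m\to\cdots\to p_0} BG(U_{p_m}),$$ the product being over the chains of $m$ composable morphisms of $\mathsf{Plot}(X)$, and let $\mathsf{Tot}(BG(QX))$ be its totalization, the simplicial set whose $k$-simplices are the maps of cosimplicial simplicial sets $\Delta^\bullet\times\Delta^k\to BG(QX)$. A vertex of it has an associated family of smooth maps $g_f\colon U_p\to G$, one for each morphism $f\colon p\to q$ of $\mathsf{Plot}(X)$ (a cocycle), given by its component in cosimplicial degree 1. A 1-simplex from $\{g_f\}$ to $\{g'_f\}$ has an associated family of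 smooth maps $h_p\colon U_p\to G$, one for each plot $p$ (a map of cocycles), given by its component in cosimplicial degree 0. Let $\mathsf{DiffPrinc}_G(X)$ be the category of diffeological principal $G$-bundles over $X$, that is, of diffeological spaces $P$ with a smooth right $G$-action and a subduction $\pi\colon P\to X$ whose fibres are preserved by the action, such that $P\times G\to P\times_X P$, $(a,g)\mapsto(a,a\cdot g)$, is a diffeomorphism; its morphisms are the smooth $G$-equivariant maps over $X$. Let $N$ denote the nerve. **Theorem.** The simplicial sets $\mathsf{Tot}(BG(QX))$ and $N\mathsf{DiffPrinc}_G(X)$ are Kan complexes, and there is a map of simplicial sets $$\varphi\colon \mathsf{Tot}(BG(QX))\to N\mathsf{DiffPrinc}_G(X)$$ with the following properties. 1. A vertex with family $g=\{g_f\}$ is sent to the bundle $$P_g=\Bigl(\coprod_p U_p\times G\Bigr)\Big/\!\sim,$$ where $\sim$ is the equivalence relation generated by $(p,u,h)\sim(q,f(u),g_f(u)h)$ for $f\colon p\to q$ in $\mathsf{Plot}(X)$, with the quotient diffeology, the projection $[p,u,h]\mapsto p(u)$ and the action $[p,u,h]\cdot k=[p,u,hk]$; in particular $P_g$ is a diffeological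 principal $G$-bundle over $X$. 2. A 1-simplex from $g$ to $g'$ with family $\{h_p\}$ is sent to the bundle map $P_g\to P_{g'}$, $[p,u,k]\mapsto[p,u,h_p(u)k]$. 3. $\varphi$ is a weak equivalence of Kan complexes: it induces a bijection on $\pi_0$ and isomorphisms on $\pi_n$ for all $n\ge1$ and all base points. -/

import Mathlib

open CategoryTheory Opposite MonoidalCategory Diffeology
open scoped Simplicial ContDiff

universe u v w

noncomputable section

/-! ## Constructions of diffeologies -/

namespace Diffeology

/-- The pullback diffeology along `f`: a parametrization is a plot iff its composite with `f` is. -/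
@[reducible]
def pullbackDiffeology {X : Type u} {Y : Type v} (f : X → Y) (d : DiffeologicalSpace Y) :
    DiffeologicalSpace X where
  plots n := {p | IsPlot (f ∘ p)}
  constant_plots _ := isPlot_const
  plot_reparam hp hf := isPlot_reparam hp hf
  locality h := d.locality fun x => by
    obtain ⟨s, hs, hx, h'⟩ := h x
    exact ⟨s, hs, hx, fun hf hf' => h' hf hf'⟩

/-- The pushforward diffeology along `f`: the diffeology generated by the composites of plots
with `f`. -/
@[reducible]
def pushforwardDiffeology {X : Type u} {Y : Type v} (f : X → Y) (_ : DiffeologicalSpace X) :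
    DiffeologicalSpace Y :=
  DiffeologicalSpace.generateFrom
    {q | ∃ p : EuclideanSpace ℝ (Fin q.1) → X, IsPlot p ∧ q.2 = f ∘ p}

/-- The product diffeology. -/
instance instDiffeologicalSpaceProd {X : Type u} {Y : Type v}
    [DiffeologicalSpace X] [DiffeologicalSpace Y] : DiffeologicalSpace (X × Y) where
  plots n := {p | IsPlot (Prod.fst ∘ p) ∧ IsPlot (Prod.snd ∘ p)}
  constant_plots _ := ⟨isPlot_const, isPlot_const⟩
  plot_reparam hp hf := ⟨isPlot_reparam hp.1 hf, isPlot_reparam hp.2 hf⟩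
  locality h := by
    constructor
    · refine DiffeologicalSpace.locality fun x => ?_
      obtain ⟨s, hs, hx, h'⟩ := h x
      exact ⟨s, hs, hx, fun hf hf' => (h' hf hf').1⟩
    · refine DiffeologicalSpace.locality fun x => ?_
      obtain ⟨s, hs, hx, h'⟩ := h x
      exact ⟨s, hs, hx, fun hf hf' => (h' hf hf').2⟩

/-- The subspace diffeology. -/
instance instDiffeologicalSpaceSubtype {X : Type u} [d : DiffeologicalSpace X] (s : X → Prop) :
    DiffeologicalSpace {x : X // s x} :=
  pullbackDiffeology Subtype.val d

/-- The coproduct diffeology: generated by the plots of the summands. -/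
instance instDiffeologicalSpaceSigma {ι : Type u} {X : ι → Type v}
    [d : ∀ i, DiffeologicalSpace (X i)] : DiffeologicalSpace (Σ i, X i) :=
  ⨆ i, pushforwardDiffeology (Sigma.mk i) (d i)

/-- The quotient diffeology (`Quot r` is the quotient by the equivalence relation generated
by `r`). -/
instance instDiffeologicalSpaceQuot {X : Type u} [d : DiffeologicalSpace X] (r : X → X → Prop) :
    DiffeologicalSpace (Quot r) :=
  pushforwardDiffeology (Quot.mk r) d

/-- A subduction: a surjection such that the target carries the pushforward diffeology. -/
def IsSubduction {X : Type u} {Y : Type v} [dX : DiffeologicalSpace X] [dY : DiffeologicalSpace Y]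
    (f : X → Y) : Prop :=
  Function.Surjective f ∧ pushforwardDiffeology f dX = dY

/-- A diffeomorphism: a smooth map with a smooth two-sided inverse. -/
def IsDiffeomorphism {X : Type u} {Y : Type v} [DiffeologicalSpace X] [DiffeologicalSpace Y]
    (f : X → Y) : Prop :=
  DSmooth f ∧ ∃ g : Y → X, DSmooth g ∧ Function.LeftInverse g f ∧ Function.RightInverse g f

/-- A diffeological group: a group whose multiplication and inversion are smooth. -/
class DiffeologicalGroup (G : Type u) [Group G] [DiffeologicalSpace G] : Prop where
  dSmooth_mul : DSmooth fun a : G × G => a.1 * a.2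
  dSmooth_inv : DSmooth fun a : G => a⁻¹

/-! ## Groups of smooth maps -/

/-- The set `C^∞(U, Y)` of smooth maps. -/
def SmoothMap (U : Type v) (Y : Type u) [DiffeologicalSpace U] [DiffeologicalSpace Y] :
    Type (max u v) :=
  {f : U → Y // DSmooth f}

instance (U : Type v) (Y : Type u) [DiffeologicalSpace U] [DiffeologicalSpace Y] :
    CoeFun (SmoothMap U Y) fun _ => U → Y := ⟨Subtype.val⟩

theorem SmoothMap.ext {U : Type v} {Y : Type u} [DiffeologicalSpace U] [DiffeologicalSpace Y]
    {f g : SmoothMap U Y} (h : ∀ x, f x = g x) : f = g :=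
  Subtype.ext (funext h)

section SmoothMap

variable {U : Type v} {V : Type w} {G : Type u} [DiffeologicalSpace U] [DiffeologicalSpace V]
  [DiffeologicalSpace G] [Group G] [DiffeologicalGroup G]

/-- Pointwise multiplication makes `C^∞(U, G)` a group. -/
instance : Group (SmoothMap U G) where
  mul f g := ⟨fun x => f x * g x, fun n p hp =>
    DiffeologicalGroup.dSmooth_mul n (fun x => (f (p x), g (p x)))
      ⟨f.2 n p hp, g.2 n p hp⟩⟩
  one := ⟨fun _ => 1, dSmooth_const⟩
  inv f := ⟨fun x => (f x)⁻¹, DiffeologicalGroup.dSmooth_inv.comp f.2⟩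
  mul_assoc f g h := SmoothMap.ext fun x => mul_assoc (f x) (g x) (h x)
  one_mul f := SmoothMap.ext fun x => one_mul (f x)
  mul_one f := SmoothMap.ext fun x => mul_one (f x)
  inv_mul_cancel f := SmoothMap.ext fun x => inv_mul_cancel (f x)

/-- Precomposition with a smooth map, as a group homomorphism `C^∞(V, G) → C^∞(U, G)`. -/
def SmoothMap.pullback (f : U → V) (hf : DSmooth f) : SmoothMap V G →* SmoothMap U G where
  toFun g := ⟨fun x => g (f x), g.2.comp hf⟩
  map_one' := rfl
  map_mul' _ _ := rfl

end SmoothMap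

/-! ## Cartesian spaces and the category of plots -/

/-- The category of cartesian spaces: its objects are the spaces `ℝⁿ`. -/
structure Cart : Type where
  dim : ℕ

/-- The underlying space `ℝⁿ` of a cartesian space. -/
abbrev Cart.space (U : Cart) : Type := EuclideanSpace ℝ (Fin U.dim)

/-- The morphisms of cartesian spaces are the smooth maps. -/
instance : Category Cart where
  Hom U V := {f : U.space → V.space // ContDiff ℝ ∞ f}
  id _ := ⟨id, contDiff_id⟩
  comp f g := ⟨g.1 ∘ f.1, g.2.comp f.2⟩

theorem Cart.dSmooth {U V : Cart} (f : U ⟶ V) : DSmooth f.1 := f.2.dSmooth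

/-- The plots of a diffeological space. -/
structure Plot (X : Type u) [DiffeologicalSpace X] : Type u where
  dom : Cart
  toFun : dom.space → X
  isPlot : IsPlot toFun

/-- A map of plots `p → q` is a smooth map `f` of the domains with `q ∘ f = p`. -/
instance (X : Type u) [DiffeologicalSpace X] : Category.{0} (Plot X) where
  Hom p q := {f : p.dom ⟶ q.dom // q.toFun ∘ f.1 = p.toFun}
  id p := ⟨𝟙 p.dom, rfl⟩
  comp {p q r} f g := ⟨f.1 ≫ g.1,
    (congrArg (fun k => k ∘ f.1.1) g.2).trans f.2⟩

/-- The functor sending a plot to its domain. -/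
def Plot.forget (X : Type u) [DiffeologicalSpace X] : Plot X ⥤ Cart where
  obj p := p.dom
  map f := f.1

/-! ## The simplicial presheaf `BG` and the cosimplicial simplicial set `BG(QX)` -/

section BG

variable (G : Type u) [Group G] [DiffeologicalSpace G] [DiffeologicalGroup G]

/-- The simplicial presheaf `BG` on cartesian spaces: the nerve of the one-object groupoid with
automorphism group `C^∞(U, G)`. In `SingleObj`, the composite of `h` followed by `k` is `k * h`. -/
def BG : Cartᵒᵖ ⥤ SSet.{u} where
  obj U := nerve (SingleObj (SmoothMap U.unop.space G))
  map f := nerveMap (SingleObj.mapHom _ _ (SmoothMap.pullback f.unop.1 (Cart.dSmooth f.unop)))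
  map_id _ := rfl
  map_comp _ _ := rfl

variable (X : Type u) [DiffeologicalSpace X]

/-- The set `N_m` of chains `p_m → ⋯ → p_0` of `m` composable maps of plots of `X`. The object
with index `0` of such a chain is its source `p_m`. -/
abbrev PlotChain (m : SimplexCategory) : Type u := (nerve (Plot X)).obj (op m)

variable {X} in
/-- The domain `U_{p_m}` of the source of a chain of maps of plots. -/
def PlotChain.source {m : SimplexCategory} (x : PlotChain X m) : Cart :=
  (ComposableArrows.left (n := m.len) x).dom

variable {X} in
/-- For `θ : [m] → [m']` and a chain `x` of length `m'`, the map from the domain of the source of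
`x` to the domain of the source of the chain `θ^* x`. -/
def PlotChain.sourceMap {m m' : SimplexCategory} (θ : m ⟶ m') (x : PlotChain X m') :
    x.source ⟶ PlotChain.source ((nerve (Plot X)).map θ.op x) :=
  (Plot.forget X).map (ComposableArrows.map' (n := m'.len) x 0 (θ.toOrderHom 0).1
    (Nat.zero_le _) (Nat.lt_succ_iff.1 (θ.toOrderHom 0).2))

variable {X} in
theorem PlotChain.sourceMap_id {m : SimplexCategory} (x : PlotChain X m) :
    PlotChain.sourceMap (𝟙 m) x = 𝟙 x.source :=
  congrArg (Plot.forget X).map (CategoryTheory.Functor.map_id (C := Fin (m.len + 1)) x _)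

variable {X} in
theorem PlotChain.sourceMap_comp {m m' m'' : SimplexCategory} (θ : m ⟶ m') (θ' : m' ⟶ m'')
    (x : PlotChain X m'') :
    PlotChain.sourceMap (θ ≫ θ') x =
      PlotChain.sourceMap θ' x ≫ PlotChain.sourceMap θ ((nerve (Plot X)).map θ'.op x) := by
  refine (congrArg (Plot.forget X).map (CategoryTheory.Functor.map_comp (C := Fin (m''.len + 1)) x
    (homOfLE (Fin.zero_le (θ'.toOrderHom 0)))
    (homOfLE (θ'.toOrderHom.monotone (Fin.zero_le (θ.toOrderHom 0)))))).trans ?_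
  exact CategoryTheory.Functor.map_comp (Plot.forget X) _ _

/-- The cosimplicial simplicial set `BG(QX)`, with `BG(QX)^m = ∏_{N_m} BG(U_{p_m})`. -/
def cosimplicialBGQ : CosimplicialObject SSet.{u} where
  obj m :=
    { obj := fun n => ∀ x : PlotChain X m, ((BG G).obj (op x.source)).obj n
      map := fun α => ↾fun s x => ((BG G).obj (op x.source)).map α (s x)
      map_id := fun n => by ext s x; simp
      map_comp := fun α β => by ext s x; simp }
  map {m m'} θ :=
    { app := fun n => ↾fun s x =>
        ((BG G).map (PlotChain.sourceMap θ x).op).app n (s ((nerve (Plot X)).map θ.op x))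
      naturality := fun n n' α => by
        ext s x
        exact (NatTrans.naturality_apply ((BG G).map (PlotChain.sourceMap θ x).op) α _).symm }
  map_id m := by
    ext n s x
    change ((BG G).map (PlotChain.sourceMap (𝟙 m) x).op).app n (s x) = s x
    rw [PlotChain.sourceMap_id]
    rfl
  map_comp θ θ' := by
    ext n s x
    change ((BG G).map (PlotChain.sourceMap (θ ≫ θ') x).op).app n _ = _
    rw [PlotChain.sourceMap_comp]
    rfl

end BG

/-! ## Totalization -/

/-- The functor `k ↦ Δ^• × Δ^k` to cosimplicial simplicial sets, with
`(Δ^• × Δ^k)^m = Δ^m × Δ^k`. -/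
def stdSimplexProd : SimplexCategory ⥤ CosimplicialObject SSet.{u} :=
  SSet.stdSimplex ⋙ tensoringRight SSet.{u} ⋙
    (Functor.whiskeringLeft SimplexCategory SSet.{u} SSet.{u}).obj SSet.stdSimplex

/-- The totalization of a cosimplicial simplicial set `Y`: its set of `k`-simplices is the set of
maps of cosimplicial simplicial sets `Δ^• × Δ^k → Y`. -/
def Tot (Y : CosimplicialObject SSet.{u}) : SSet.{u} :=
  stdSimplexProd.op ⋙ yoneda.obj Y

section Cocycles

variable {G : Type u} [Group G] [DiffeologicalSpace G] [DiffeologicalGroup G]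
  {X : Type u} [DiffeologicalSpace X]

/-- The `n`-simplex of `(Δ^m × Δ^k)` given by two maps `[n] → [m]` and `[n] → [k]`. -/
def stdSimplexProdMk {n m k : SimplexCategory} (a : n ⟶ m) (b : n ⟶ k) :
    ((stdSimplexProd.{u}.obj k).obj m).obj (op n) :=
  (SSet.stdSimplex.objEquiv.symm a, SSet.stdSimplex.objEquiv.symm b)

/-- The plot-indexed cocycle `{g_f}` of a vertex `t : Δ^• → BG(QX)` of the totalization:
`g_f : U_p → G` is the component at the chain `f : p → q` of the value of `t` on the
1-simplex `id` of `Δ^1`. -/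
def Tot.cocycle (t : (Tot (cosimplicialBGQ G X)) _⦋0⦌) {p q : Plot X} (f : p ⟶ q) :
    SmoothMap p.dom.space G :=
  ComposableArrows.hom (((t.app ⦋1⦌).app (op ⦋1⦌)
    (stdSimplexProdMk (𝟙 ⦋1⦌) (SimplexCategory.σ 0))) (ComposableArrows.mk₁ f))

/-- The collection `{h_p}` of a 1-simplex `s : Δ^• × Δ^1 → BG(QX)` of the totalization:
`h_p : U_p → G` is the component at `p` of the value of `s` on the nondegenerate 1-simplex
of `Δ^0 × Δ^1`. -/
def Tot.cocycleMap (s : (Tot (cosimplicialBGQ G X)) _⦋1⦌) (p : Plot X) :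
    SmoothMap p.dom.space G :=
  ComposableArrows.hom (((s.app ⦋0⦌).app (op ⦋1⦌)
    (stdSimplexProdMk (SimplexCategory.σ 0) (𝟙 ⦋1⦌))) (ComposableArrows.mk₀ p))

end Cocycles

/-! ## Diffeological principal bundles -/

section Bundles

variable (G : Type u) [Group G] [DiffeologicalSpace G] (X : Type u) [DiffeologicalSpace X]

/-- A diffeological space `P` with a map `π : P → X` and an operation `P × G → P`. These are the
data of a principal bundle; the conditions on them are in `IsPrincipalBundle`. -/
structure BundleData : Type (u + 1) where
  carrier : Type u
  [diffeology : DiffeologicalSpace carrier]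
  proj : carrier → X
  act : carrier → G → carrier

attribute [instance] BundleData.diffeology

variable {G X}

/-- The fibre product `P ×_X P`, with the subspace diffeology of `P × P`. -/
abbrev BundleData.FibreProduct (P : BundleData G X) : Type u :=
  {r : P.carrier × P.carrier // P.proj r.1 = P.proj r.2}

/-- `π : P → X` is a diffeological principal `G`-bundle: `P` is a diffeological space with a smooth
right action of `G` preserving the fibres of `π`, the map `π` is a subduction, and
`P × G → P ×_X P`, `(p, g) ↦ (p, p · g)`, is a diffeomorphism. -/
structure BundleData.IsPrincipalBundle (P : BundleData G X) : Prop where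
  act_one : ∀ a, P.act a 1 = a
  act_mul : ∀ a g h, P.act a (g * h) = P.act (P.act a g) h
  dSmooth_act : DSmooth fun r : P.carrier × G => P.act r.1 r.2
  proj_act : ∀ a g, P.proj (P.act a g) = P.proj a
  isSubduction : IsSubduction P.proj
  isDiffeomorphism : IsDiffeomorphism fun r : P.carrier × G =>
    (⟨(r.1, P.act r.1 r.2), (proj_act r.1 r.2).symm⟩ : P.FibreProduct)

variable (G X) in
/-- The diffeological principal `G`-bundles over `X`. -/
structure DiffPrinc : Type (u + 1) where
  toBundleData : BundleData G X
  isPrincipalBundle : toBundleData.IsPrincipalBundle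

/-- A map of principal bundles over `X`: a smooth `G`-equivariant map commuting with the
projections to `X`. -/
@[ext]
structure DiffPrinc.Hom (P Q : DiffPrinc G X) : Type u where
  toFun : P.toBundleData.carrier → Q.toBundleData.carrier
  dSmooth : DSmooth toFun
  equivariant : ∀ a g, toFun (P.toBundleData.act a g) = Q.toBundleData.act (toFun a) g
  proj_comp : ∀ a, Q.toBundleData.proj (toFun a) = P.toBundleData.proj a

/-- The category `DiffPrinc_G(X)`. -/
instance : Category.{u} (DiffPrinc G X) where
  Hom := DiffPrinc.Hom
  id _ := ⟨id, dSmooth_id, fun _ _ => rfl, fun _ => rfl⟩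
  comp f g := ⟨g.toFun ∘ f.toFun, g.dSmooth.comp f.dSmooth,
    fun a h => (congrArg g.toFun (f.equivariant a h)).trans (g.equivariant _ _),
    fun a => (g.proj_comp _).trans (f.proj_comp a)⟩

/-! ## The bundle glued from a plot-indexed family -/

/-- The relation on `∐_p U_p × G` with `(p, u, h) ~ (q, v, k)` iff there is a map of plots
`f : p → q` such that `v = f(u)` and `k = g_f(u) h`. -/
def GlueRel (g : ∀ {p q : Plot X}, (p ⟶ q) → SmoothMap p.dom.space G)
    (a b : Σ p : Plot X, p.dom.space × G) : Prop :=
  ∃ f : a.1 ⟶ b.1, b.2.1 = f.1.1 a.2.1 ∧ b.2.2 = g f a.2.1 * a.2.2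

/-- The space `P` glued from the family `{g_f}`: the quotient of `∐_p U_p × G` by the equivalence
relation generated by `GlueRel`, with the quotient diffeology, the projection `[p, u, h] ↦ p(u)`
and the action `[p, u, h] · k = [p, u, h k]`. -/
def gluedBundle (g : ∀ {p q : Plot X}, (p ⟶ q) → SmoothMap p.dom.space G) : BundleData G X where
  carrier := Quot (GlueRel g)
  proj := Quot.lift (fun a => a.1.toFun a.2.1) (by
    rintro a b ⟨f, hx, -⟩
    rw [hx]
    exact (congrFun f.2 a.2.1).symm)
  act a k := Quot.map (fun b => ⟨b.1, b.2.1, b.2.2 * k⟩) (by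
    rintro b c ⟨f, hx, hk⟩
    exact ⟨f, hx, by rw [hk, mul_assoc]⟩) a

/-- The point `[p, u, h]` of the glued bundle. -/
def gluedBundle.mk (g : ∀ {p q : Plot X}, (p ⟶ q) → SmoothMap p.dom.space G)
    (p : Plot X) (x : p.dom.space) (h : G) : (gluedBundle g).carrier :=
  Quot.mk _ ⟨p, x, h⟩

end Bundles

/-! ## Weak equivalences of Kan complexes -/

/-- The `n`-th homotopy group (as a set) of a Kan complex `K` at a vertex `x`: maps `Δ^n → K` that
are constant at `x` on the boundary, up to homotopy relative to the boundary. -/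
abbrev HomotopySet (n : ℕ) (K : SSet.{u}) (x : K _⦋0⦌) : Type u :=
  SSet.RelativeMorphism.HomotopyClass (SSet.boundary n) (SSet.Subcomplex.ofSimplex x)
    (SSet.const ⟨x, SSet.Subcomplex.mem_ofSimplex_obj x⟩)

/-- The map `π_n(K, x) → π_n(L, φ(x))` induced by `φ : K → L`. -/
def HomotopySet.map (n : ℕ) {K L : SSet.{u}} (φ : K ⟶ L) (x : K _⦋0⦌) :
    HomotopySet n K x → HomotopySet n L (φ.app _ x) := fun a =>
  a.postcomp (SSet.RelativeMorphism.ofSimplex₀ φ x (φ.app _ x) rfl) rfl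

/-- A map of Kan complexes is a weak equivalence iff it induces a bijection on `π₀` and
isomorphisms on all homotopy groups `π_n`, `n ≥ 1`, at all base points. -/
structure IsKanWeakEquivalence {K L : SSet.{u}} (φ : K ⟶ L) : Prop where
  kanComplex_source : SSet.KanComplex K
  kanComplex_target : SSet.KanComplex L
  bijective_pi_zero : Function.Bijective (SSet.mapπ₀ φ)
  bijective_pi : ∀ (n : ℕ), 1 ≤ n → ∀ x : K _⦋0⦌, Function.Bijective (HomotopySet.map n φ x)

end Diffeology

end

/-!
The simplicial set `Tot (cosimplicialBGQ G X)` is itself the nerve of a groupoid, namely of the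
groupoid `Cocycle G X` of plot-indexed cocycles, and the comparison map is the nerve of the glueing
functor `Cocycle.glue` to principal bundles. So the theorem splits into three statements.

*The totalization is a nerve.* A `k`-simplex of the totalization assigns to every chain of `m` maps
of plots a compatible family of functors from the simplices of `Δ^m × Δ^k` to the group
`C^∞(U, G)`, that is, labels of the edges of `Δ^m × Δ^k` which multiply along composition. By
compatibility with the cosimplicial structure every label is the product of one coming from an edge
of `Δ^1 × Δ^0` and one coming from an edge of `Δ^0 × Δ^1` (`Tot.edge_eq_mul`), so that the simplex
is the same as a functor from `[k]` to cocycles (`Tot.equivCocycles`).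

*Glueing is an equivalence.* The set underlying the bundle glued from a cocycle is identified with
`X × G` by comparing every `[p, u, h]` with the fibre over the constant plot at `p(u)`
(`Cocycle.coord`). In these terms the quotient diffeology can be computed: a parametrization `r` is
a plot iff its projection `p` is a plot and `r(u) = [p, u, h(u)]` for a smooth map `h`
(`Cocycle.isPlot_iff_isPlotOfBundle`). This makes the glued space a principal bundle and glueing
fully faithful. For essential surjectivity one needs a smooth section of a given bundle over every
plot; these define its cocycle (`DiffPrinc.cocycle`). They exist because a diffeological principal
bundle over `ℝⁿ` is trivial (`exists_section`): subductions admit local sections, two sections on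
overlapping boxes can be glued after extending their quotient, a map from the overlap to `G`, by
precomposing it with a smooth map into the overlap, a compact box is covered by finitely many
small ones, and finally the boxes exhaust `ℝⁿ`. Sections over plots also show that maps of principal
bundles have smooth inverses (`DiffPrinc.Hom.symm`), so that principal bundles form a groupoid.

*Nerves of groupoids.* A simplicial set presented as the nerve of a groupoid is a Kan complex
(`NerveModel.kanComplex`), and an equivalence of groupoids induces a weak equivalence
(`NerveModel.isKanWeakEquivalence`). The latter uses that for `n ≥ 1` a sphere `Δ^n → K` based at
`x` and a homotopy of such spheres have all vertices equal to `x`, and that a fully faithful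
functor restricts to an isomorphism on the simplices of this kind. The notion `NerveModel` lets the
totalization, its lift to a larger universe and the nerve of the category of bundles be treated
alike.
-/

noncomputable section

namespace Diffeology

/-! ### Local smoothness, local lifts and sections of principal bundles -/

section PlotOn

variable {X : Type u} [DiffeologicalSpace X] {Y : Type v} [DiffeologicalSpace Y] {n m : ℕ}

/-- A parametrization `ρ` restricts to a smooth map on the set `V`: its composites with all
smooth maps into `V` are plots. The values of `ρ` outside `V` do not matter. -/
def IsPlotOn (V : Set (EuclideanSpace ℝ (Fin n))) (ρ : EuclideanSpace ℝ (Fin n) → X) : Prop :=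
  ∀ ⦃m : ℕ⦄ ⦃f : EuclideanSpace ℝ (Fin m) → EuclideanSpace ℝ (Fin n)⦄,
    ContDiff ℝ ∞ f → (∀ x, f x ∈ V) → IsPlot (ρ ∘ f)

variable {V W : Set (EuclideanSpace ℝ (Fin n))} {ρ ρ' : EuclideanSpace ℝ (Fin n) → X}

theorem isPlotOn_univ : IsPlotOn Set.univ ρ ↔ IsPlot ρ :=
  ⟨fun h => h contDiff_id fun _ => trivial, fun h _ _ hf _ => isPlot_reparam h hf⟩

theorem IsPlotOn.mono (h : IsPlotOn V ρ) (hWV : W ⊆ V) : IsPlotOn W ρ :=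
  fun _ _ hf hfW => h hf fun x => hWV (hfW x)

theorem IsPlot.isPlotOn (h : IsPlot ρ) : IsPlotOn V ρ :=
  (isPlotOn_univ.2 h).mono (Set.subset_univ V)

theorem IsPlotOn.congr (h : IsPlotOn V ρ) (e : Set.EqOn ρ ρ' V) : IsPlotOn V ρ' := by
  intro m f hf hfV
  rw [show ρ' ∘ f = ρ ∘ f from funext fun x => (e (hfV x)).symm]
  exact h hf hfV

theorem IsPlotOn.comp {W : Set (EuclideanSpace ℝ (Fin m))} (h : IsPlotOn V ρ)
    {f : EuclideanSpace ℝ (Fin m) → EuclideanSpace ℝ (Fin n)} (hf : ContDiff ℝ ∞ f)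
    (hfV : Set.MapsTo f W V) : IsPlotOn W (ρ ∘ f) :=
  fun _ _ hg hgW => h (hf.comp hg) fun x => hfV (hgW x)

theorem IsPlotOn.of_locally (h : ∀ x ∈ V, ∃ W, IsOpen W ∧ x ∈ W ∧ IsPlotOn W ρ) :
    IsPlotOn V ρ := by
  intro m f hf hfV
  refine DiffeologicalSpace.locality fun x => ?_
  obtain ⟨W, hW, hx, hρ⟩ := h (f x) (hfV x)
  exact ⟨f ⁻¹' W, hW.preimage hf.continuous, hx, fun hgW hg => hρ (hf.comp hg) hgW⟩

/-- Restrict a smooth map on `E` to a ball: there is a smooth map which takes values in the ball of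
radius `R` and is the identity on the smaller ball of radius `r`. -/
theorem exists_contDiff_eq_id_on_ball {E : Type*} [NormedAddCommGroup E] [InnerProductSpace ℝ E]
    [FiniteDimensional ℝ E] (c : E) {r R : ℝ} (hr : 0 < r) (hR : r < R) :
    ∃ f : E → E, ContDiff ℝ ∞ f ∧ (∀ x, f x ∈ Metric.ball c R) ∧
      ∀ x ∈ Metric.ball c r, f x = x := by
  let χ : ContDiffBump c := ⟨r, R, hr, hR⟩
  refine ⟨fun x => c + χ x • (x - c), ?_, fun x => ?_, fun x hx => ?_⟩
  · exact contDiff_const.add (χ.contDiff.smul (contDiff_id.sub contDiff_const))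
  · rw [mem_ball_iff_norm, add_sub_cancel_left, norm_smul, Real.norm_of_nonneg χ.nonneg]
    by_cases hx : x ∈ Metric.ball c R
    · rw [mem_ball_iff_norm] at hx
      exact (mul_le_of_le_one_left (norm_nonneg _) χ.le_one).trans_lt hx
    · rw [χ.zero_of_le_dist (not_lt.1 hx), zero_mul]
      exact hr.trans hR
  · dsimp only
    rw [χ.one_of_mem_closedBall (Metric.ball_subset_closedBall hx), one_smul, add_sub_cancel]

/-- Plots lift locally along a subduction: the parametrizations of the target which lift locally
form a diffeology, which contains the composites of plots with `f`. -/
theorem isSubduction_exists_local_lift {f : X → Y} (hf : IsSubduction f)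
    {q : EuclideanSpace ℝ (Fin n) → Y} (hq : IsPlot q) (x : EuclideanSpace ℝ (Fin n)) :
    ∃ V, IsOpen V ∧ x ∈ V ∧ ∃ ρ : EuclideanSpace ℝ (Fin n) → X,
      IsPlotOn V ρ ∧ ∀ y ∈ V, f (ρ y) = q y := by
  let d : DiffeologicalSpace Y :=
    { plots := fun n => {q | ∀ x, ∃ V, IsOpen V ∧ x ∈ V ∧ ∃ ρ : EuclideanSpace ℝ (Fin n) → X,
        IsPlotOn V ρ ∧ ∀ y ∈ V, f (ρ y) = q y}
      constant_plots := fun {n} y x => by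
        obtain ⟨a, rfl⟩ := hf.1 y
        exact ⟨Set.univ, isOpen_univ, trivial, fun _ => a, isPlotOn_univ.2 isPlot_const,
          fun _ _ => rfl⟩
      plot_reparam := fun {n m p g} hp hg x => by
        obtain ⟨V, hV, hx, ρ, hρ, h⟩ := hp (g x)
        exact ⟨g ⁻¹' V, hV.preimage hg.continuous, hx, ρ ∘ g, hρ.comp hg fun _ => id,
          fun y hy => h _ hy⟩
      locality := fun {n p} hp x => by
        obtain ⟨W, hW, hx, h⟩ := hp x
        obtain ⟨R, hR, hRW⟩ := Metric.isOpen_iff.1 hW x hx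
        -- `p` agrees near `x` with its composite with a smooth map into `W`
        obtain ⟨g, hg, hgR, hgid⟩ := exists_contDiff_eq_id_on_ball x (half_pos hR)
          (half_lt_self hR)
        obtain ⟨V, hV, hx', ρ, hρ, e⟩ := h (fun y => hRW (hgR y)) hg x
        refine ⟨V ∩ Metric.ball x (R / 2), hV.inter Metric.isOpen_ball,
          ⟨hx', Metric.mem_ball_self (half_pos hR)⟩, ρ, hρ.mono Set.inter_subset_left,
          fun y hy => (e y hy.1).trans ?_⟩
        exact congrArg p (hgid y hy.2) }
  have hd : pushforwardDiffeology f inferInstance ≤ d := by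
    refine DiffeologicalSpace.generateFrom_le_iff.2 ?_
    rintro n q ⟨p, hp, e⟩ x
    exact ⟨Set.univ, isOpen_univ, trivial, p, isPlotOn_univ.2 hp, fun y _ => (congrFun e y).symm⟩
  rw [hf.2] at hd
  exact DiffeologicalSpace.le_iff'.1 hd n q hq x

end PlotOn

section Sections

variable {G : Type u} {X : Type u} {P : BundleData G X}

/-- `σ` is a smooth section over the set `V` of the pullback along `p` of the bundle `P`. -/
structure IsSectionOn (P : BundleData G X) {n : ℕ} (p : EuclideanSpace ℝ (Fin n) → X)
    (V : Set (EuclideanSpace ℝ (Fin n))) (σ : EuclideanSpace ℝ (Fin n) → P.carrier) : Prop where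
  isPlotOn : IsPlotOn V σ
  proj_eq : ∀ x ∈ V, P.proj (σ x) = p x

variable {n : ℕ} {p : EuclideanSpace ℝ (Fin n) → X}

theorem IsSectionOn.mono {V W : Set (EuclideanSpace ℝ (Fin n))}
    {σ : EuclideanSpace ℝ (Fin n) → P.carrier} (h : IsSectionOn P p V σ) (hWV : W ⊆ V) :
    IsSectionOn P p W σ :=
  ⟨h.isPlotOn.mono hWV, fun x hx => h.proj_eq x (hWV hx)⟩

variable [Group G] [DiffeologicalSpace G] [DiffeologicalSpace X]

namespace BundleData.IsPrincipalBundle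

/-- The element of `G` carrying `a` to `b`, for two points `a` and `b` of the same fibre of a
principal bundle (and a junk value if `a` and `b` lie in different fibres). -/
def div (hP : P.IsPrincipalBundle) (a b : P.carrier) : G := by
  classical
  exact if h : P.proj a = P.proj b then (hP.isDiffeomorphism.2.choose ⟨(a, b), h⟩).2 else 1

theorem act_div (hP : P.IsPrincipalBundle) {a b : P.carrier} (h : P.proj a = P.proj b) :
    P.act a (hP.div a b) = b := by
  have e := hP.isDiffeomorphism.2.choose_spec.2.2 ⟨(a, b), h⟩
  rw [div, dif_pos h]
  have e₁ := congrArg (fun r : P.FibreProduct => r.1.1) e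
  have e₂ := congrArg (fun r : P.FibreProduct => r.1.2) e
  dsimp only at e₁ e₂
  rwa [e₁] at e₂

theorem div_act (hP : P.IsPrincipalBundle) (a : P.carrier) (g : G) :
    hP.div a (P.act a g) = g := by
  have e := hP.isDiffeomorphism.2.choose_spec.2.1 (a, g)
  rw [div, dif_pos (hP.proj_act a g).symm]
  exact congrArg Prod.snd e

theorem act_injective (hP : P.IsPrincipalBundle) (a : P.carrier) : Function.Injective (P.act a) :=
  fun g h e => by rw [← hP.div_act a g, e, hP.div_act]

theorem isPlotOn_div (hP : P.IsPrincipalBundle) {n : ℕ} {V : Set (EuclideanSpace ℝ (Fin n))}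
    {r r' : EuclideanSpace ℝ (Fin n) → P.carrier} (hr : IsPlotOn V r) (hr' : IsPlotOn V r')
    (h : ∀ x ∈ V, P.proj (r x) = P.proj (r' x)) : IsPlotOn V fun x => hP.div (r x) (r' x) := by
  intro m f hf hfV
  have hs : IsPlot fun x => (⟨(r (f x), r' (f x)), h _ (hfV x)⟩ : P.FibreProduct) :=
    ⟨hr hf hfV, hr' hf hfV⟩
  have := (hP.isDiffeomorphism.2.choose_spec.1 m _ hs).2
  convert this using 1
  funext x
  exact dif_pos (h _ (hfV x))

theorem isPlotOn_act (hP : P.IsPrincipalBundle) {n : ℕ} {V : Set (EuclideanSpace ℝ (Fin n))}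
    {r : EuclideanSpace ℝ (Fin n) → P.carrier} {g : EuclideanSpace ℝ (Fin n) → G}
    (hr : IsPlotOn V r) (hg : IsPlotOn V g) : IsPlotOn V fun x => P.act (r x) (g x) :=
  fun m f hf hfV => hP.dSmooth_act m (fun x => (r (f x), g (f x))) ⟨hr hf hfV, hg hf hfV⟩

theorem isPlot_div (hP : P.IsPrincipalBundle) {n : ℕ}
    {r r' : EuclideanSpace ℝ (Fin n) → P.carrier} (hr : IsPlot r) (hr' : IsPlot r')
    (h : ∀ x, P.proj (r x) = P.proj (r' x)) : IsPlot fun x => hP.div (r x) (r' x) :=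
  isPlotOn_univ.1 (hP.isPlotOn_div hr.isPlotOn hr'.isPlotOn fun x _ => h x)

theorem isPlot_act (hP : P.IsPrincipalBundle) {n : ℕ}
    {r : EuclideanSpace ℝ (Fin n) → P.carrier} {g : EuclideanSpace ℝ (Fin n) → G}
    (hr : IsPlot r) (hg : IsPlot g) : IsPlot fun x => P.act (r x) (g x) :=
  hP.dSmooth_act n (fun x => (r x, g x)) ⟨hr, hg⟩

end BundleData.IsPrincipalBundle

/-- Glueing of two sections `σ₁` over `V₁` and `σ₂` over `V₂`. On the overlap `σ₁ = σ₂ · g`, and the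
smooth map `l` serves to extend `g` from `A ∩ B` to `B`, as `g ∘ l`. -/
theorem IsSectionOn.exists_union (hP : P.IsPrincipalBundle)
    {V₁ V₂ A B : Set (EuclideanSpace ℝ (Fin n))} {σ₁ σ₂ : EuclideanSpace ℝ (Fin n) → P.carrier}
    (h₁ : IsSectionOn P p V₁ σ₁) (h₂ : IsSectionOn P p V₂ σ₂) (hA : IsOpen A) (hB : IsOpen B)
    (hAV : A ⊆ V₁) (hBV : B ⊆ V₂) {l : EuclideanSpace ℝ (Fin n) → EuclideanSpace ℝ (Fin n)}
    (hl : ContDiff ℝ ∞ l) (hlB : Set.MapsTo l B (V₁ ∩ V₂)) (hlid : ∀ x ∈ A ∩ B, l x = x) :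
    ∃ σ, IsSectionOn P p (A ∪ B) σ ∧ Set.EqOn σ σ₁ A := by
  classical
  have hproj : ∀ x ∈ V₁ ∩ V₂, P.proj (σ₂ x) = P.proj (σ₁ x) := fun x hx =>
    (h₂.proj_eq x hx.2).trans (h₁.proj_eq x hx.1).symm
  let g : EuclideanSpace ℝ (Fin n) → G := fun x => hP.div (σ₂ x) (σ₁ x)
  have hg : IsPlotOn (V₁ ∩ V₂) g := hP.isPlotOn_div (h₂.isPlotOn.mono Set.inter_subset_right)
    (h₁.isPlotOn.mono Set.inter_subset_left) hproj
  let τ : EuclideanSpace ℝ (Fin n) → P.carrier := fun x => P.act (σ₂ x) (g (l x))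
  have hτ : IsPlotOn B τ := hP.isPlotOn_act (h₂.isPlotOn.mono hBV) (hg.comp hl hlB)
  let σ : EuclideanSpace ℝ (Fin n) → P.carrier := fun x => if x ∈ A then σ₁ x else τ x
  have hσA : Set.EqOn σ₁ σ A := fun x hx => (if_pos hx).symm
  have hσB : Set.EqOn τ σ B := fun x hx => by
    by_cases hxA : x ∈ A
    · refine Eq.trans ?_ (if_pos hxA).symm
      change P.act (σ₂ x) (g (l x)) = _
      rw [hlid x ⟨hxA, hx⟩]
      exact hP.act_div (hproj x ⟨hAV hxA, hBV hx⟩)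
    · exact (if_neg hxA).symm
  refine ⟨σ, ⟨IsPlotOn.of_locally fun x hx => ?_, fun x hx => ?_⟩, hσA.symm⟩
  · rcases hx with hx | hx
    · exact ⟨A, hA, hx, (h₁.isPlotOn.mono hAV).congr hσA⟩
    · exact ⟨B, hB, hx, hτ.congr hσB⟩
  · rcases hx with hx | hx
    · rw [← hσA hx, h₁.proj_eq x (hAV hx)]
    · rw [← hσB hx]
      exact (hP.proj_act _ _).trans (h₂.proj_eq x (hBV hx))

end Sections

/-! ### Principal bundles over a cartesian space are trivial -/

section GlobalSections

variable {G : Type u} {X : Type u} [Group G] [DiffeologicalSpace G] [DiffeologicalSpace X]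
  {P : BundleData G X} {n : ℕ}

/-- The open box `∏ ]a i, b i[` in `ℝⁿ`. -/
def openBox (a b : Fin n → ℝ) : Set (EuclideanSpace ℝ (Fin n)) :=
  {x | ∀ i, a i < x i ∧ x i < b i}

theorem isOpen_openBox (a b : Fin n → ℝ) : IsOpen (openBox a b) := by
  have h : openBox a b = ⋂ i, ({x | a i < x i} ∩ {x | x i < b i}) :=
    Set.ext fun x => by simp [openBox]
  rw [h]
  exact isOpen_iInter_of_finite fun i => (isOpen_lt continuous_const (by fun_prop)).inter
    (isOpen_lt (by fun_prop) continuous_const)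

variable {p : EuclideanSpace ℝ (Fin n) → X}

theorem exists_isSectionOn_nhd (hP : P.IsPrincipalBundle) (hp : IsPlot p)
    (x : EuclideanSpace ℝ (Fin n)) : ∃ V, IsOpen V ∧ x ∈ V ∧ ∃ σ, IsSectionOn P p V σ := by
  obtain ⟨V, hV, hx, σ, hσ, h⟩ := isSubduction_exists_local_lift hP.isSubduction hp x
  exact ⟨V, hV, hx, σ, hσ, h⟩

/-- Sections over two boxes which overlap in the `j`-th coordinate and agree in the other ones
give a section over the union of the boxes. -/
theorem exists_isSectionOn_openBox_of_overlap (hP : P.IsPrincipalBundle) {a b : Fin n → ℝ}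
    (j : Fin n) {s t : ℝ} (has : a j ≤ s) (hst : s < t) (htb : t ≤ b j)
    (h₁ : ∃ σ, IsSectionOn P p (openBox a (Function.update b j t)) σ)
    (h₂ : ∃ σ, IsSectionOn P p (openBox (Function.update a j s) b) σ) :
    ∃ σ, IsSectionOn P p (openBox a b) σ := by
  obtain ⟨σ₁, h₁⟩ := h₁
  obtain ⟨σ₂, h₂⟩ := h₂
  -- the two boxes overlap where the `j`-th coordinate is in the ball of centre `c` and radius `r`
  let c := (s + t) / 2
  let r := (t - s) / 2
  have hr : 0 < r := by simp only [r]; linarith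
  obtain ⟨μ, hμ, hμr, hμid⟩ := exists_contDiff_eq_id_on_ball c (half_pos hr) (half_lt_self hr)
  let l : EuclideanSpace ℝ (Fin n) → EuclideanSpace ℝ (Fin n) := fun x =>
    WithLp.toLp 2 (Function.update (fun i => x i) j (μ (x j)))
  have hl : ContDiff ℝ ∞ l := by
    rw [contDiff_euclidean]
    intro i
    by_cases hi : i = j
    · subst hi
      simp only [l, Function.update_self]
      exact hμ.comp (contDiff_euclidean.1 contDiff_id i)
    · simp only [l, Function.update_of_ne hi]
      exact contDiff_euclidean.1 contDiff_id i
  have hlj : ∀ x, l x j = μ (x j) := fun x => by simp [l]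
  have hli : ∀ x i, i ≠ j → l x i = x i := fun x i hi => by simp [l, hi]
  have hV₁ : ∀ x, x ∈ openBox a (Function.update b j t) ↔
      (a j < x j ∧ x j < t) ∧ ∀ i, i ≠ j → a i < x i ∧ x i < b i := fun x => by
    constructor
    · exact fun h => ⟨by simpa using h j, fun i hi => by simpa [hi] using h i⟩
    · rintro ⟨h, h'⟩ i
      by_cases hi : i = j
      · subst hi; simpa using h
      · simpa [hi] using h' i hi
  have hV₂ : ∀ x, x ∈ openBox (Function.update a j s) b ↔
      (s < x j ∧ x j < b j) ∧ ∀ i, i ≠ j → a i < x i ∧ x i < b i := fun x => by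
    constructor
    · exact fun h => ⟨by simpa using h j, fun i hi => by simpa [hi] using h i⟩
    · rintro ⟨h, h'⟩ i
      by_cases hi : i = j
      · subst hi; simpa using h
      · simpa [hi] using h' i hi
  have hcr : c + r = t ∧ c - r = s := by constructor <;> simp only [c, r] <;> ring
  let A := openBox a b ∩ {x | x j < c + r / 2}
  let B := openBox a b ∩ {x | c - r / 2 < x j}
  have hA : IsOpen A := (isOpen_openBox a b).inter (isOpen_lt (by fun_prop) continuous_const)
  have hB : IsOpen B := (isOpen_openBox a b).inter (isOpen_lt continuous_const (by fun_prop))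
  obtain ⟨σ, hσ, -⟩ := IsSectionOn.exists_union hP h₁ h₂ hA hB
    (fun x hx => (hV₁ x).2 ⟨⟨(hx.1 j).1, by linarith [show x j < c + r / 2 from hx.2]⟩,
      fun i _ => hx.1 i⟩)
    (fun x hx => (hV₂ x).2 ⟨⟨by linarith [show c - r / 2 < x j from hx.2], (hx.1 j).2⟩,
      fun i _ => hx.1 i⟩)
    hl (fun x hx => by
      have h := hμr (x j)
      rw [Real.ball_eq_Ioo, Set.mem_Ioo, hcr.1, hcr.2] at h
      rw [Set.mem_inter_iff, hV₁, hV₂, hlj]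
      have h' : ∀ i, i ≠ j → a i < l x i ∧ l x i < b i := fun i hi => by
        rw [hli x i hi]
        exact hx.1 i
      exact ⟨⟨⟨has.trans_lt h.1, h.2⟩, h'⟩, ⟨⟨h.1, h.2.trans_le htb⟩, h'⟩⟩)
    (fun x hx => by
      have h1 : x j < c + r / 2 := hx.1.2
      have h2 : c - r / 2 < x j := hx.2.2
      ext i
      by_cases hi : i = j
      · subst hi
        rw [hlj]
        refine hμid _ ?_
        rw [Real.ball_eq_Ioo]
        exact ⟨h2, h1⟩
      · exact hli x i hi)
  refine ⟨σ, hσ.mono fun x hx => ?_⟩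
  by_cases h : x j < c + r / 2
  · exact Or.inl ⟨hx, h⟩
  · refine Or.inr ⟨hx, ?_⟩
    change c - r / 2 < x j
    linarith

/-- There is a section over every box: by compactness there are sections over all boxes with small
sides, and the sides can be enlarged one after the other. -/
theorem exists_isSectionOn_openBox (hP : P.IsPrincipalBundle) (hp : IsPlot p) (a₀ b₀ : Fin n → ℝ) :
    ∃ σ, IsSectionOn P p (openBox a₀ b₀) σ := by
  choose V hV hxV hσ using exists_isSectionOn_nhd hP hp
  obtain ⟨δ, hδ, hδV⟩ := lebesgue_number_lemma_of_metric (s := Set.Icc a₀ b₀)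
    (c := fun x => WithLp.toLp 2 ⁻¹' V x) isCompact_Icc
    (fun x => (hV x).preimage (PiLp.continuous_toLp 2 _))
    (fun x _ => Set.mem_iUnion.2 ⟨WithLp.toLp 2 x, hxV _⟩)
  have main : ∀ S : Finset (Fin n), ∀ a b : Fin n → ℝ, a₀ ≤ a → b ≤ b₀ →
      (∀ i, i ∉ S → b i - a i ≤ δ) → ∃ σ, IsSectionOn P p (openBox a b) σ := by
    intro S
    induction S using Finset.induction_on with
    | empty =>
      intro a b ha hb hab
      rcases (openBox a b).eq_empty_or_nonempty with h | ⟨x, hx⟩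
      · obtain ⟨σ, hσ⟩ := hσ 0
        exact ⟨σ, hσ.mono (h ▸ Set.empty_subset _)⟩
      · obtain ⟨y, hy⟩ := hδV (WithLp.ofLp x)
          ⟨fun i => (ha i).trans (hx i).1.le, fun i => (hx i).2.le.trans (hb i)⟩
        obtain ⟨σ, hσ⟩ := hσ y
        refine ⟨σ, hσ.mono fun z hz => hy (a := WithLp.ofLp z) ?_⟩
        rw [Metric.mem_ball, dist_pi_lt_iff hδ]
        intro i
        have h1 := hx i
        have h2 := hz i
        have h3 := hab i (Finset.notMem_empty i)
        rw [Real.dist_eq, abs_sub_lt_iff]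
        constructor <;> linarith
    | insert j S _ ih =>
      have step : ∀ k : ℕ, ∀ a b : Fin n → ℝ, a₀ ≤ a → b ≤ b₀ →
          (∀ i, i ∉ insert j S → b i - a i ≤ δ) → b j - a j ≤ δ + k * (δ / 2) →
          ∃ σ, IsSectionOn P p (openBox a b) σ := by
        intro k
        induction k with
        | zero =>
          intro a b ha hb hab hj
          refine ih a b ha hb fun i hi => ?_
          by_cases hij : i = j
          · subst hij
            simpa using hj
          · exact hab i (by simp [hij, hi])
        | succ k ihk =>
          intro a b ha hb hab hj
          by_cases hj' : b j - a j ≤ δ + k * (δ / 2)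
          · exact ihk a b ha hb hab hj'
          · have hk : 0 ≤ k * (δ / 2) := by positivity
            push_cast at hj
            -- cut off a slab of width `δ`, which overlaps the rest of the box in width `δ / 2`
            refine exists_isSectionOn_openBox_of_overlap hP j (s := b j - δ) (t := b j - δ / 2)
              (by linarith) (by linarith) (by linarith) ?_ ?_
            · refine ihk _ _ ha (fun i => ?_) (fun i hi => ?_) ?_
              · by_cases hij : i = j
                · subst hij
                  rw [Function.update_self]
                  linarith [hb i]
                · rw [Function.update_of_ne hij]
                  exact hb i
              · rw [Function.update_of_ne (fun h => hi (by simp [h]))]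
                exact hab i hi
              · rw [Function.update_self]
                linarith
            · refine ih _ _ (fun i => ?_) hb fun i hi => ?_
              · by_cases hij : i = j
                · subst hij
                  rw [Function.update_self]
                  linarith [ha i]
                · rw [Function.update_of_ne hij]
                  exact ha i
              · by_cases hij : i = j
                · subst hij
                  rw [Function.update_self]
                  linarith
                · rw [Function.update_of_ne hij]
                  exact hab i (by simp [hij, hi])
      intro a b ha hb hab
      obtain ⟨k, hk⟩ := exists_nat_ge ((b j - a j) / (δ / 2))
      refine step k a b ha hb hab ?_
      rw [div_le_iff₀ (half_pos hδ)] at hk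
      linarith
  exact main Finset.univ a₀ b₀ le_rfl le_rfl fun i hi => absurd (Finset.mem_univ i) hi

/-- A diffeological principal bundle over `ℝⁿ` is trivial: the pullback of a principal bundle along
a plot has a smooth section, which is glued from sections over balls of increasing radius. -/
theorem exists_section (hP : P.IsPrincipalBundle) (hp : IsPlot p) :
    ∃ σ : EuclideanSpace ℝ (Fin n) → P.carrier, IsPlot σ ∧ ∀ x, P.proj (σ x) = p x := by
  let B : ℕ → Set (EuclideanSpace ℝ (Fin n)) := fun k => Metric.ball 0 (k + 1)
  have hB : Monotone B := fun k l h => Metric.ball_subset_ball (by gcongr)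
  have ball : ∀ k : ℕ, ∃ σ, IsSectionOn P p (B k) σ := by
    intro k
    obtain ⟨σ, hσ⟩ := exists_isSectionOn_openBox hP hp (fun _ => -((k : ℝ) + 1))
      (fun _ => (k : ℝ) + 1)
    refine ⟨σ, hσ.mono fun x hx i => ?_⟩
    have h1 : ‖x i‖ ≤ ‖x‖ := PiLp.norm_apply_le x i
    have h2 : ‖x‖ < k + 1 := mem_ball_zero_iff.1 hx
    exact abs_lt.1 (h1.trans_lt h2)
  -- the section over the ball of radius `k + 2` can be extended after being restricted to
  -- the ball of radius `k + 1`
  have extend : ∀ (k : ℕ) (σ : EuclideanSpace ℝ (Fin n) → P.carrier),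
      IsSectionOn P p (B (k + 1)) σ →
      ∃ τ, IsSectionOn P p (B (k + 2)) τ ∧ Set.EqOn τ σ (B k) := by
    intro k σ hσ
    obtain ⟨σ', hσ'⟩ := ball (k + 2)
    obtain ⟨l, hl, hlr, hlid⟩ := exists_contDiff_eq_id_on_ball (0 : EuclideanSpace ℝ (Fin n))
      (r := k + 1) (R := (k + 1 : ℕ) + 1) (by positivity) (by push_cast; linarith)
    obtain ⟨τ, hτ, hτ'⟩ := IsSectionOn.exists_union hP hσ hσ' (A := B k) (B := B (k + 2))
      Metric.isOpen_ball Metric.isOpen_ball (hB (by omega)) subset_rfl hl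
      (fun x _ => ⟨hlr x, hB (by omega) (hlr x)⟩) (fun x hx => hlid x hx.1)
    exact ⟨τ, hτ.mono Set.subset_union_right, hτ'⟩
  choose ext hext hext' using extend
  obtain ⟨σ₀, hσ₀⟩ := ball 1
  let τ : ∀ k : ℕ, {σ // IsSectionOn P p (B (k + 1)) σ} := fun k =>
    Nat.rec ⟨σ₀, hσ₀⟩ (fun k σ => ⟨ext k σ.1 σ.2, hext k σ.1 σ.2⟩) k
  have hτ : ∀ k l : ℕ, k ≤ l → Set.EqOn (τ l).1 (τ k).1 (B k) := by
    intro k l hkl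
    induction l, hkl using Nat.le_induction with
    | base => exact fun _ _ => rfl
    | succ l hkl ih => exact fun x hx => (hext' l (τ l).1 (τ l).2 (hB hkl hx)).trans (ih hx)
  have mem : ∀ x : EuclideanSpace ℝ (Fin n), x ∈ B ⌈‖x‖⌉₊ := fun x =>
    mem_ball_zero_iff.2 ((Nat.le_ceil _).trans_lt (lt_add_one _))
  let σ : EuclideanSpace ℝ (Fin n) → P.carrier := fun x => (τ ⌈‖x‖⌉₊).1 x
  have hσ : ∀ k, Set.EqOn (τ k).1 σ (B k) := by
    intro k x hx
    rcases le_total k ⌈‖x‖⌉₊ with h | h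
    · exact (hτ _ _ h hx).symm
    · exact hτ _ _ h (mem x)
  refine ⟨σ, isPlotOn_univ.1 (IsPlotOn.of_locally fun x _ => ?_), fun x => ?_⟩
  · exact ⟨B ⌈‖x‖⌉₊, Metric.isOpen_ball, mem x,
      ((τ _).2.isPlotOn.mono (hB (Nat.le_succ _))).congr (hσ _)⟩
  · exact (τ _).2.proj_eq x (hB (Nat.le_succ _) (mem x))

end GlobalSections

/-! ### Nerves of groupoids are Kan complexes -/

/-- A presentation of a simplicial set `Z` as the nerve of a category `C`: bijections from the
`n`-simplices of `Z` to the functors `[n] ⥤ C`, natural in `[n]`. The universes of `Z` and `C` are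
independent. -/
structure NerveModel (Z : SSet.{w}) (C : Type u) [Category.{v} C] where
  equiv (n : SimplexCategory) : Z.obj (op n) ≃ (Fin (n.len + 1) ⥤ C)
  equiv_map {n n' : SimplexCategory} (c : n' ⟶ n) (z : Z.obj (op n)) :
    equiv n' (Z.map c.op z) = (SimplexCategory.toCat.map c).toFunctor ⋙ equiv n z

section LabelHom

variable {C : Type u} [Category.{v} C]

/-- The morphisms of a functor, transported along equalities of its values with given objects. -/
def labelHom {J : Type w} [Preorder J] (S : J ⥤ C) {V : J → C} (h : ∀ t, S.obj t = V t) {s t : J}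
    (st : s ≤ t) : V s ⟶ V t :=
  eqToHom (h s).symm ≫ S.map (homOfLE st) ≫ eqToHom (h t)

variable {J : Type w} [Preorder J] (S : J ⥤ C) {V : J → C} (h : ∀ t, S.obj t = V t)

theorem labelHom_congr {S S' : J ⥤ C} {V : J → C} (e : S = S') (h : ∀ t, S.obj t = V t)
    (h' : ∀ t, S'.obj t = V t) {s t : J} (st : s ≤ t) : labelHom S h st = labelHom S' h' st := by
  subst e
  rfl

theorem labelHom_trans {s t r : J} (st : s ≤ t) (tr : t ≤ r) :
    labelHom S h st ≫ labelHom S h tr = labelHom S h (st.trans tr) := by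
  have : S.map (homOfLE (st.trans tr)) = S.map (homOfLE st) ≫ S.map (homOfLE tr) :=
    S.map_comp (homOfLE st) (homOfLE tr)
  simp [labelHom, this]

theorem functor_ext_of_labelHom {S S' : J ⥤ C} (h : ∀ t, S.obj t = S'.obj t)
    (H : ∀ {s t : J} (st : s ≤ t), labelHom S h st = S'.map (homOfLE st)) : S = S' :=
  CategoryTheory.Functor.ext h fun s t f => by
    have := H (leOfHom f)
    simp only [labelHom] at this
    rw [show f = homOfLE (leOfHom f) from rfl, ← this]
    simp

end LabelHom

section Filling

theorem mkOfLe_comp {k m : SimplexCategory} {s t : Fin (k.len + 1)} (st : s ≤ t) (a : k ⟶ m) :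
    (SimplexCategory.mkOfLe s t st : ⦋1⦌ ⟶ ⦋k.len⦌) ≫ a =
      (SimplexCategory.mkOfLe _ _ (a.toOrderHom.monotone st) : ⦋1⦌ ⟶ ⦋m.len⦌) := by
  ext r
  fin_cases r <;> rfl

/-- An order map `[k] → [N]` lies in the horn `Λ[N, i]` iff it misses a vertex other than `i`. -/
def InHorn {N : ℕ} (i : Fin (N + 1)) {k : SimplexCategory} (a : k ⟶ ⦋N⦌) : Prop :=
  ∃ j, j ≠ i ∧ ∀ t, a.toOrderHom t ≠ j

theorem InHorn.precomp {N : ℕ} {i : Fin (N + 1)} {k k' : SimplexCategory} {a : k ⟶ ⦋N⦌}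
    (ha : InHorn i a) (c : k' ⟶ k) : InHorn i (c ≫ a) := by
  obtain ⟨j, hj, h⟩ := ha
  exact ⟨j, hj, fun t => h _⟩

/-- A horn in the nerve of a groupoid has a filler. The functor `[N] ⥤ C` is built from the
isomorphisms from the vertex `i` to the other vertices, which all are given by edges of the horn. -/
theorem exists_functor_of_horn {C : Type u} [Groupoid.{v} C] {N : ℕ} (i : Fin (N + 3))
    (S : ∀ {k : SimplexCategory} (a : k ⟶ ⦋N + 2⦌), InHorn i a → (Fin (k.len + 1) ⥤ C))
    (hS : ∀ {k k' : SimplexCategory} (a : k ⟶ ⦋N + 2⦌) (ha : InHorn i a) (c : k' ⟶ k),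
      S (c ≫ a) (ha.precomp c) = (SimplexCategory.toCat.map c).toFunctor ⋙ S a ha) :
    ∃ F : Fin (N + 3) ⥤ C, ∀ {k : SimplexCategory} (a : k ⟶ ⦋N + 2⦌) (ha : InHorn i a),
      S a ha = (SimplexCategory.toCat.map a).toFunctor ⋙ F := by
  have missing : ∀ j l : Fin (N + 3), ∃ m, m ≠ j ∧ m ≠ l := by
    intro j l
    by_contra! h
    have h1 : (Finset.univ : Finset (Fin (N + 3))) ⊆ {j, l} := fun m _ => by
      by_cases hm : m = j
      · simp [hm]
      · simp [h m hm]
    have := (Finset.card_le_card h1).trans Finset.card_le_two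
    simp at this
  have good0 : ∀ j : Fin (N + 3), InHorn i (SimplexCategory.const ⦋0⦌ ⦋N + 2⦌ j) := fun j => by
    obtain ⟨m, h1, h2⟩ := missing i j
    exact ⟨m, h1, fun t => h2.symm⟩
  let V : Fin (N + 3) → C := fun j => (S _ (good0 j)).obj 0
  have hV : ∀ {k : SimplexCategory} (a : k ⟶ ⦋N + 2⦌) (ha : InHorn i a) (t : Fin (k.len + 1)),
      (S a ha).obj t = V (a.toOrderHom t) := by
    intro k a ha t
    have h := hS a ha (SimplexCategory.const ⦋0⦌ k t)
    exact (congrArg (fun F : Fin 1 ⥤ C => F.obj 0) h).symm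
  -- the edge `j → l` lies in the horn as soon as some face other than the `i`-th contains it; this
  -- can fail only in dimension 2, for the edge opposite to `i`
  have good1 : ∀ {j l : Fin (N + 3)} (hjl : j ≤ l), (∃ m, m ≠ i ∧ m ≠ j ∧ m ≠ l) →
      InHorn i (SimplexCategory.mkOfLe j l hjl) := by
    rintro j l hjl ⟨m, h1, h2, h3⟩
    refine ⟨m, h1, fun t => ?_⟩
    match t with
    | 0 => exact h2.symm
    | 1 => exact h3.symm
  let E : ∀ {j l : Fin (N + 3)} (hjl : j ≤ l), (∃ m, m ≠ i ∧ m ≠ j ∧ m ≠ l) → (V j ⟶ V l) :=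
    fun {j l} hjl hm => labelHom (V := fun t => V ((SimplexCategory.mkOfLe j l hjl).toOrderHom t))
      (S _ (good1 hjl hm)) (hV _ _) (Fin.zero_le (1 : Fin 2))
  have hE : ∀ {k : SimplexCategory} (a : k ⟶ ⦋N + 2⦌) (ha : InHorn i a) {s t : Fin (k.len + 1)}
      (st : s ≤ t) (hm : ∃ m, m ≠ i ∧ m ≠ a.toOrderHom s ∧ m ≠ a.toOrderHom t),
      labelHom (S a ha) (hV a ha) st = E (a.toOrderHom.monotone st) hm := by
    intro k a ha s t st hm
    have h : ∀ (b : ⦋1⦌ ⟶ ⦋N + 2⦌) (hb : InHorn i b),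
        (SimplexCategory.mkOfLe s t st : ⦋1⦌ ⟶ ⦋k.len⦌) ≫ a = b →
        S b hb = (SimplexCategory.toCat.map
          (SimplexCategory.mkOfLe s t st : ⦋1⦌ ⟶ ⦋k.len⦌)).toFunctor ⋙ S a ha := by
      rintro _ hb rfl
      exact hS a ha _
    exact (labelHom_congr (h (SimplexCategory.mkOfLe _ _ (a.toOrderHom.monotone st)) (good1 _ hm)
      (mkOfLe_comp st a)) (hV _ _)
      (fun r => match r with
        | 0 => hV a ha s
        | 1 => hV a ha t) (s := (0 : Fin 2)) (t := (1 : Fin 2))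
      (Fin.zero_le _)).symm
  have hEtrans : ∀ {j l r : Fin (N + 3)} (hjl : j ≤ l) (hlr : l ≤ r)
      (hm : ∃ m, m ≠ i ∧ m ≠ j ∧ m ≠ l ∧ m ≠ r),
      E hjl (hm.imp fun m h => ⟨h.1, h.2.1, h.2.2.1⟩) ≫
        E hlr (hm.imp fun m h => ⟨h.1, h.2.2.1, h.2.2.2⟩) =
      E (hjl.trans hlr) (hm.imp fun m h => ⟨h.1, h.2.1, h.2.2.2⟩) := by
    intro j l r hjl hlr hm
    let a : ⦋2⦌ ⟶ ⦋N + 2⦌ := SimplexCategory.mkOfLeComp j l r hjl hlr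
    have ha : InHorn i a := by
      obtain ⟨m, h1, h2, h3, h4⟩ := hm
      refine ⟨m, h1, fun t => ?_⟩
      match t with
      | 0 => exact h2.symm
      | 1 => exact h3.symm
      | 2 => exact h4.symm
    have h01 := hE a ha (s := (0 : Fin 3)) (t := (1 : Fin 3)) (by decide)
      (hm.imp fun m h => ⟨h.1, h.2.1, h.2.2.1⟩)
    have h12 := hE a ha (s := (1 : Fin 3)) (t := (2 : Fin 3)) (by decide)
      (hm.imp fun m h => ⟨h.1, h.2.2.1, h.2.2.2⟩)
    have h02 := hE a ha (s := (0 : Fin 3)) (t := (2 : Fin 3)) (by decide)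
      (hm.imp fun m h => ⟨h.1, h.2.1, h.2.2.2⟩)
    exact (congrArg₂ (· ≫ ·) h01.symm h12.symm).trans ((labelHom_trans _ _ _ _).trans h02)
  -- so edges at the vertex `i` always lie in the horn
  have gi : ∀ j : Fin (N + 3), ∃ m, m ≠ i ∧ m ≠ i ∧ m ≠ j := fun j =>
    (missing i j).imp fun m h => ⟨h.1, h.1, h.2⟩
  have gi' : ∀ j : Fin (N + 3), ∃ m, m ≠ i ∧ m ≠ j ∧ m ≠ i := fun j =>
    (missing i j).imp fun m h => ⟨h.1, h.2, h.1⟩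
  let e : ∀ j : Fin (N + 3), V i ⟶ V j := fun j =>
    if h : i ≤ j then E h (gi j) else Groupoid.inv (E (le_of_not_ge h) (gi' j))
  have he : ∀ {j l : Fin (N + 3)} (hjl : j ≤ l) (hm : ∃ m, m ≠ i ∧ m ≠ j ∧ m ≠ l),
      e j ≫ E hjl hm = e l := by
    intro j l hjl hm
    by_cases hj : i ≤ j
    · have hl := hj.trans hjl
      simp only [e, hj, hl, dif_pos]
      exact hEtrans hj hjl (hm.imp fun m h => ⟨h.1, h.1, h.2.1, h.2.2⟩)
    · by_cases hl : i ≤ l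
      · simp only [e, hj, hl, dif_pos, dif_neg, not_false_eq_true]
        rw [← hEtrans (le_of_not_ge hj) hl (hm.imp fun m h => ⟨h.1, h.2.1, h.1, h.2.2⟩),
          ← Category.assoc, Groupoid.inv_comp, Category.id_comp]
      · simp only [e, hj, hl, dif_neg, not_false_eq_true]
        rw [← hEtrans hjl (le_of_not_ge hl) (hm.imp fun m h => ⟨h.1, h.2.1, h.2.2, h.1⟩)]
        simp only [Groupoid.inv_eq_inv, IsIso.inv_comp, Category.assoc, IsIso.inv_hom_id,
          Category.comp_id]
  let F : Fin (N + 3) ⥤ C :=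
    { obj := V
      map := fun {j l} _ => Groupoid.inv (e j) ≫ e l
      map_id := fun j => Groupoid.inv_comp _
      map_comp := fun {j l r} _ _ => by simp [Groupoid.inv_eq_inv] }
  refine ⟨F, fun {k} a ha => functor_ext_of_labelHom (hV a ha) fun {s t} st => ?_⟩
  -- the edge from `a s` to `a t` and the vertex `i` span at most a triangle of the horn
  have hm : ∃ m, m ≠ i ∧ m ≠ a.toOrderHom s ∧ m ≠ a.toOrderHom t := by
    obtain ⟨m, h, h'⟩ := ha
    exact ⟨m, h, (h' s).symm, (h' t).symm⟩
  refine (hE a ha st hm).trans ?_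
  change _ = Groupoid.inv (e (a.toOrderHom s)) ≫ e (a.toOrderHom t)
  rw [← he (a.toOrderHom.monotone st) hm, ← Category.assoc, Groupoid.inv_comp, Category.id_comp]

/-- A simplicial set presented as the nerve of a groupoid is a Kan complex. -/
theorem NerveModel.kanComplex {Z : SSet.{w}} {C : Type u} [Groupoid.{v} C] (M : NerveModel Z C) :
    SSet.KanComplex Z := by
  rw [SSet.KanComplex.iff]
  intro n i f hf
  obtain _ | n := n
  · obtain ⟨j, hj⟩ : ∃ j : Fin 2, j ≠ i := exists_ne i
    refine ⟨SSet.stdSimplex.σ 0 ≫ f j hj, fun l hl => ?_⟩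
    obtain rfl : l = j := by omega
    rw [← Category.assoc]
    have h : SSet.stdSimplex.δ l ≫ SSet.stdSimplex.σ 0 = 𝟙 (Δ[0] : SSet.{w}) :=
      SSet.yonedaEquiv.injective (SSet.stdSimplex.objEquiv.injective
        (SimplexCategory.Hom.ext _ _ (OrderHom.ext _ _ (funext fun t =>
          Subsingleton.elim (α := Fin 1) _ _))))
    rw [h, Category.id_comp]
  · have mem : ∀ {k : SimplexCategory} (a : k ⟶ ⦋n + 2⦌), InHorn i a →
        SSet.stdSimplex.objEquiv.symm a ∈ (SSet.horn (n + 2) i).obj (op k) := by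
      rintro k a ⟨j, hj, h⟩
      rw [SSet.mem_horn_iff]
      intro hu
      have : j ∈ Set.univ := Set.mem_univ j
      rw [← hu] at this
      rcases this with ⟨t, ht⟩ | h'
      · exact h t ht
      · exact hj h'
    obtain ⟨F, hF⟩ := exists_functor_of_horn i
      (fun {k} a ha => M.equiv k (hf.desc.app (op k) ⟨SSet.stdSimplex.objEquiv.symm a, mem a ha⟩))
      (fun {k k'} a ha c => by
        rw [← M.equiv_map]
        congr 1
        exact NatTrans.naturality_apply hf.desc c.op ⟨SSet.stdSimplex.objEquiv.symm a, mem a ha⟩)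
    refine ⟨SSet.yonedaEquiv.symm ((M.equiv ⦋n + 2⦌).symm F), fun j hj => ?_⟩
    apply SSet.yonedaEquiv.injective
    apply (M.equiv _).injective
    have hj' : InHorn i (SimplexCategory.δ j) :=
      ⟨j, hj, fun t => Fin.succAbove_ne j t⟩
    have h₁ : SSet.yonedaEquiv (f j hj) = hf.desc.app (op ⦋n + 1⦌)
        ⟨SSet.stdSimplex.objEquiv.symm (SimplexCategory.δ j), mem _ hj'⟩ := by
      rw [← SSet.horn.IsCompatible.ι_desc hf j hj, SSet.yonedaEquiv_comp]
      exact congrArg _ (SSet.horn.yonedaEquiv_ι i j hj)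
    rw [h₁, SSet.stdSimplex.yonedaEquiv_δ_comp, Equiv.apply_symm_apply]
    refine (M.equiv_map _ _).trans ?_
    rw [Equiv.apply_symm_apply]
    exact (hF (SimplexCategory.δ j) hj').symm

end Filling

/-! ### Homotopy sets of nerves of groupoids -/

section Eilenberg

/-- All vertices of the simplex `k` are equal to `x`. -/
def HasVertices {K : SSet.{u}} (x : K _⦋0⦌) {n : SimplexCategory} (k : K.obj (op n)) : Prop :=
  ∀ v : ⦋0⦌ ⟶ n, K.map v.op k = x

theorem HasVertices.map {K : SSet.{u}} {x : K _⦋0⦌} {n n' : SimplexCategory} {k : K.obj (op n)}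
    (h : HasVertices x k) (c : n' ⟶ n) : HasVertices x (K.map c.op k) := fun v => by
  rw [← h (v ≫ c), op_comp, Functor.map_comp_apply]

theorem hasVertices_app {A K : SSet.{u}} {x : K _⦋0⦌} (f : A ⟶ K)
    (hf : ∀ a : A _⦋0⦌, f.app _ a = x) {n : SimplexCategory} (a : A.obj (op n)) :
    HasVertices x (f.app _ a) := fun v => by
  rw [← NatTrans.naturality_apply, hf]

/-- The map `φ` restricts to an isomorphism from the simplices all of whose vertices are `x` to the
simplices all of whose vertices are `φ(x)`. -/
structure IsIsoOnVertices {K L : SSet.{u}} (φ : K ⟶ L) (x : K _⦋0⦌) : Prop where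
  injective {n : SimplexCategory} {k k' : K.obj (op n)} (hk : HasVertices x k)
    (hk' : HasVertices x k') (h : φ.app _ k = φ.app _ k') : k = k'
  surjective {n : SimplexCategory} {l : L.obj (op n)} (hl : HasVertices (φ.app _ x) l) :
    ∃ k : K.obj (op n), HasVertices x k ∧ φ.app _ k = l

namespace IsIsoOnVertices

variable {K L : SSet.{u}} {φ : K ⟶ L} {x : K _⦋0⦌}

theorem hom_ext (H : IsIsoOnVertices φ x) {A : SSet.{u}} {f g : A ⟶ K}
    (hf : ∀ a : A _⦋0⦌, f.app _ a = x) (hg : ∀ a : A _⦋0⦌, g.app _ a = x)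
    (h : f ≫ φ = g ≫ φ) : f = g := by
  refine SSet.hom_ext fun n => ?_
  ext a
  exact H.injective (hasVertices_app f hf a) (hasVertices_app g hg a)
    (ConcreteCategory.congr_hom (NatTrans.congr_app h n) a)

theorem exists_lift (H : IsIsoOnVertices φ x) {A : SSet.{u}} (f : A ⟶ L)
    (hf : ∀ a : A _⦋0⦌, f.app _ a = φ.app _ x) :
    ∃ g : A ⟶ K, (∀ a : A _⦋0⦌, g.app _ a = x) ∧ g ≫ φ = f := by
  choose g hg hg' using fun (n : SimplexCategory) (a : A.obj (op n)) =>
    H.surjective (hasVertices_app f hf a)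
  refine ⟨{ app := fun n => ↾fun a => g n.unop a, naturality := fun n n' c => ?_ },
    fun a => ?_, ?_⟩
  · ext a
    refine H.injective (hg _ _) ((hg _ _).map c.unop) ?_
    refine (hg' _ _).trans ((NatTrans.naturality_apply f c a).trans ?_)
    refine Eq.trans ?_ (NatTrans.naturality_apply φ c (g _ a)).symm
    exact congrArg (L.map c) (hg' _ a).symm
  · have := hg ⦋0⦌ a (𝟙 _)
    rwa [op_id, Functor.map_id_apply] at this
  · refine SSet.hom_ext fun n => ?_
    ext a
    exact hg' _ a

end IsIsoOnVertices

theorem const_app_zero {A K : SSet.{u}} (y : K _⦋0⦌) (a : A _⦋0⦌) :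
    (SSet.const y : A ⟶ K).app _ a = y := by
  change K.map (SimplexCategory.const ⦋0⦌ ⦋0⦌ 0).op y = y
  rw [SimplexCategory.const_eq_id, op_id, Functor.map_id_apply]

theorem const_comp_ofSimplex_ι {A K : SSet.{u}} (x : K _⦋0⦌) :
    (SSet.const ⟨x, SSet.Subcomplex.mem_ofSimplex_obj x⟩ :
      A ⟶ (SSet.Subcomplex.ofSimplex x : SSet)) ≫ (SSet.Subcomplex.ofSimplex x).ι =
      SSet.const x :=
  SSet.const_comp _ _

theorem RelativeMorphism.app_vertex {K : SSet.{u}} {x : K _⦋0⦌} {n : ℕ} (hn : 1 ≤ n)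
    (f : SSet.RelativeMorphism (SSet.boundary n) (SSet.Subcomplex.ofSimplex x)
      (SSet.const ⟨x, SSet.Subcomplex.mem_ofSimplex_obj x⟩)) (a : (Δ[n] : SSet.{u}) _⦋0⦌) :
    f.map.app _ a = x := by
  have ha : a ∈ (SSet.boundary.{u} n).obj (op ⦋0⦌) := by
    rw [SSet.boundary_obj_eq_univ 0 n (by omega)]
    trivial
  rw [f.map_eq_of_mem a ha]
  exact congrArg Subtype.val (const_app_zero (A := (SSet.boundary n : SSet))
    (K := SSet.Subcomplex.ofSimplex x) ⟨x, SSet.Subcomplex.mem_ofSimplex_obj x⟩ ⟨a, ha⟩)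

/-- If `φ` restricts to an isomorphism from the simplices with all vertices `x` to the simplices
with all vertices `φ(x)`, it induces bijections on the homotopy groups at `x`: for `n ≥ 1` all
vertices of `Δ^n` and of `Δ^n × Δ^1` lie over the boundary, so that spheres and homotopies
lift uniquely. -/
theorem IsIsoOnVertices.bijective_homotopySet {K L : SSet.{u}} {φ : K ⟶ L} {x : K _⦋0⦌}
    (H : IsIsoOnVertices φ x) {n : ℕ} (hn : 1 ≤ n) :
    Function.Bijective (HomotopySet.map n φ x) := by
  have hb : ∀ a : (Δ[n] : SSet.{u}) _⦋0⦌, a ∈ (SSet.boundary.{u} n).obj (op ⦋0⦌) := fun a => by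
    rw [SSet.boundary_obj_eq_univ 0 n (by omega)]
    trivial
  -- the unique lift of a sphere
  have lift : ∀ f : SSet.RelativeMorphism (SSet.boundary n)
      (SSet.Subcomplex.ofSimplex (φ.app _ x))
      (SSet.const ⟨φ.app _ x, SSet.Subcomplex.mem_ofSimplex_obj _⟩),
      ∃ g : SSet.RelativeMorphism (SSet.boundary n) (SSet.Subcomplex.ofSimplex x)
        (SSet.const ⟨x, SSet.Subcomplex.mem_ofSimplex_obj x⟩), g.map ≫ φ = f.map := by
    intro f
    obtain ⟨g, hg, hg'⟩ := H.exists_lift f.map (RelativeMorphism.app_vertex hn f)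
    refine ⟨⟨g, H.hom_ext (fun a => hg _) (fun a => const_app_zero _ _) ?_⟩, hg'⟩
    rw [Category.assoc, hg', f.comm, const_comp_ofSimplex_ι, const_comp_ofSimplex_ι,
      SSet.const_comp]
  choose lift hlift using lift
  have unique : ∀ g g' : SSet.RelativeMorphism (SSet.boundary n) (SSet.Subcomplex.ofSimplex x)
        (SSet.const ⟨x, SSet.Subcomplex.mem_ofSimplex_obj x⟩), g.map ≫ φ = g'.map ≫ φ → g = g' :=
    fun g g' h => SSet.RelativeMorphism.ext (H.hom_ext (RelativeMorphism.app_vertex hn g)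
      (RelativeMorphism.app_vertex hn g') h)
  let inv : HomotopySet n L (φ.app _ x) → HomotopySet n K x :=
    Quot.lift (fun f => (lift f).homotopyClass) (by
      rintro f f' ⟨h⟩
      have hv : ∀ a : (Δ[n] ⊗ Δ[1] : SSet.{u}) _⦋0⦌, h.h.app _ a = φ.app _ x := by
        intro a
        let b : ((SSet.boundary n : SSet.{u}) ⊗ Δ[1] : SSet.{u}) _⦋0⦌ := (⟨a.1, hb a.1⟩, a.2)
        have := ConcreteCategory.congr_hom (NatTrans.congr_app h.rel (op ⦋0⦌)) b
        rw [const_comp_ofSimplex_ι, SSet.comp_const] at this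
        exact this.trans (const_app_zero _ _)
      obtain ⟨g, hg, hg'⟩ := H.exists_lift h.h hv
      refine SSet.RelativeMorphism.Homotopy.eq ⟨g, ?_, ?_, ?_⟩
      · refine H.hom_ext (fun a => hg _) (RelativeMorphism.app_vertex hn _) ?_
        rw [Category.assoc, hg', h.h₀, hlift]
      · refine H.hom_ext (fun a => hg _) (RelativeMorphism.app_vertex hn _) ?_
        rw [Category.assoc, hg', h.h₁, hlift]
      · refine H.hom_ext (fun a => hg _) (fun a => const_app_zero _ _) ?_
        rw [Category.assoc, hg', h.rel, const_comp_ofSimplex_ι, const_comp_ofSimplex_ι,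
          SSet.comp_const, SSet.comp_const, SSet.const_comp])
  refine Function.bijective_iff_has_inverse.2 ⟨inv, fun a => ?_, fun a => ?_⟩
  · obtain ⟨g, rfl⟩ := a.eq_homotopyClass
    exact congrArg _ (unique _ _ (hlift _))
  · obtain ⟨f, rfl⟩ := a.eq_homotopyClass
    exact congrArg _ (SSet.RelativeMorphism.ext (hlift f))

end Eilenberg

section FullyFaithful

variable {J : Type w} [Category.{v} J] {C : Type*} [Category* C] {D : Type*} [Category* D]

/-- Along a fully faithful functor `G`, the diagrams with all values equal to `G.obj c` lift to
diagrams with all values equal to `c`. -/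
theorem exists_functor_comp_eq (G : C ⥤ D) [G.Full] [G.Faithful] (c : C) (y : J ⥤ D)
    (hy : ∀ j, y.obj j = G.obj c) : ∃ F : J ⥤ C, (∀ j, F.obj j = c) ∧ F ⋙ G = y := by
  refine ⟨{ obj := fun _ => c
            map := fun {i j} f => G.preimage (eqToHom (hy i).symm ≫ y.map f ≫ eqToHom (hy j))
            map_id := fun i => G.map_injective (by simp)
            map_comp := fun {i j k} f g => G.map_injective (by simp) }, fun _ => rfl, ?_⟩
  exact CategoryTheory.Functor.ext (fun j => (hy j).symm) fun i j f => by simp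

theorem functor_eq_of_comp_eq (G : C ⥤ D) [G.Faithful] (F F' : J ⥤ C)
    (hobj : ∀ j, F.obj j = F'.obj j) (h : F ⋙ G = F' ⋙ G) : F = F' :=
  CategoryTheory.Functor.ext hobj fun i j f => G.map_injective (by
    have := CategoryTheory.Functor.congr_hom h f
    simpa [eqToHom_map] using this)

end FullyFaithful

namespace NerveModel

variable {Z : SSet.{w}} {C : Type u} [Category.{v} C] (M : NerveModel Z C)

/-- The object of `C` corresponding to a vertex of `Z`. -/
def vertex (z : Z _⦋0⦌) : C := (M.equiv ⦋0⦌ z).obj (0 : Fin 1)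

theorem vertex_injective : Function.Injective M.vertex := fun _ _ h =>
  (M.equiv ⦋0⦌).injective (ComposableArrows.ext₀ h)

theorem vertex_surjective : Function.Surjective M.vertex := fun c =>
  ⟨(M.equiv ⦋0⦌).symm (ComposableArrows.mk₀ c), by
    rw [vertex, Equiv.apply_symm_apply]; rfl⟩

theorem vertex_map {n : SimplexCategory} (v : ⦋0⦌ ⟶ n) (z : Z.obj (op n)) :
    M.vertex (Z.map v.op z) = (M.equiv n z).obj (v.toOrderHom 0) := by
  rw [vertex, M.equiv_map]
  rfl

theorem hasVertices_iff {n : SimplexCategory} (x : Z _⦋0⦌) (z : Z.obj (op n)) :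
    HasVertices x z ↔ ∀ j, (M.equiv n z).obj j = M.vertex x := by
  refine ⟨fun h j => ?_, fun h v => M.vertex_injective ?_⟩
  · rw [← h (SimplexCategory.const ⦋0⦌ n j), vertex_map]
    rfl
  · rw [vertex_map, h]

/-- Two vertices of the nerve of a groupoid lie in the same component iff the objects are
isomorphic. -/
theorem π₀_mk_eq_iff {C : Type u} [Groupoid.{v} C] (M : NerveModel Z C) (z z' : Z _⦋0⦌) :
    SSet.π₀.mk z = SSet.π₀.mk z' ↔ Nonempty (M.vertex z ⟶ M.vertex z') := by
  constructor
  · rw [SSet.π₀.mk_eq_mk_iff]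
    intro h
    induction h with
    | rel x y h =>
      obtain ⟨e⟩ := h
      have f := (M.equiv ⦋1⦌ e.edge).map (homOfLE (Fin.zero_le (1 : Fin 2)))
      have h₀ := M.vertex_map (SimplexCategory.δ 1) e.edge
      have h₁ := M.vertex_map (SimplexCategory.δ 0) e.edge
      have h₀' : M.vertex x = _ := (congrArg M.vertex e.src_eq).symm.trans h₀
      have h₁' : M.vertex y = _ := (congrArg M.vertex e.tgt_eq).symm.trans h₁
      exact ⟨eqToHom h₀' ≫ f ≫ eqToHom h₁'.symm⟩
    | refl x => exact ⟨𝟙 _⟩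
    | symm x y _ h => exact h.map Groupoid.inv
    | trans x y z _ _ h h' => exact h.elim fun f => h'.map fun g => f ≫ g
  · rintro ⟨f⟩
    refine SSet.π₀.sound (SSet.Edge.mk ((M.equiv ⦋1⦌).symm (ComposableArrows.mk₁ f)) ?_ ?_)
    · refine M.vertex_injective ((M.vertex_map (SimplexCategory.δ 1) _).trans ?_)
      rw [Equiv.apply_symm_apply]
      rfl
    · refine M.vertex_injective ((M.vertex_map (SimplexCategory.δ 0) _).trans ?_)
      rw [Equiv.apply_symm_apply]
      rfl

variable {K L : SSet.{w}} {C : Type u} [Groupoid.{v} C] {D : Type*} [Groupoid D]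

/-- A map of nerves of groupoids given by an equivalence of groupoids is a weak equivalence. On `π₀`
it is the bijection of isomorphism classes. On `π_n` with `n ≥ 1`, full faithfulness suffices: it
identifies the simplices with all vertices `x` with those with all vertices `φ(x)`. -/
theorem isKanWeakEquivalence (M : NerveModel K C) (N : NerveModel L D) (φ : K ⟶ L) (G : C ⥤ D)
    [G.Full] [G.Faithful] [G.EssSurj]
    (hφ : ∀ (n : SimplexCategory) (k : K.obj (op n)), N.equiv n (φ.app _ k) = M.equiv n k ⋙ G) :
    IsKanWeakEquivalence φ := by
  have hv : ∀ z : K _⦋0⦌, N.vertex (φ.app _ z) = G.obj (M.vertex z) := fun z => by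
    rw [vertex, hφ]
    rfl
  refine ⟨M.kanComplex, N.kanComplex, ⟨fun a b h => ?_, fun b => ?_⟩, fun n hn x => ?_⟩
  · obtain ⟨a, rfl⟩ := a.mk_surjective
    obtain ⟨b, rfl⟩ := b.mk_surjective
    rw [SSet.mapπ₀_mk, SSet.mapπ₀_mk, N.π₀_mk_eq_iff, hv, hv] at h
    exact (M.π₀_mk_eq_iff _ _).2 (h.map G.preimage)
  · obtain ⟨b, rfl⟩ := b.mk_surjective
    obtain ⟨a, ha⟩ := M.vertex_surjective (G.objPreimage (N.vertex b))
    refine ⟨SSet.π₀.mk a, ?_⟩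
    rw [SSet.mapπ₀_mk, N.π₀_mk_eq_iff, hv, ha]
    exact ⟨(G.objObjPreimageIso _).hom⟩
  · refine IsIsoOnVertices.bijective_homotopySet ⟨fun {n k k'} hk hk' h => ?_,
      fun {n l} hl => ?_⟩ hn
    · rw [M.hasVertices_iff] at hk hk'
      refine (M.equiv n).injective (functor_eq_of_comp_eq G _ _
        (fun j => (hk j).trans (hk' j).symm) ?_)
      rw [← hφ, ← hφ, h]
    · rw [N.hasVertices_iff, hv] at hl
      obtain ⟨F, hF, hF'⟩ := exists_functor_comp_eq G _ _ hl
      refine ⟨(M.equiv n).symm F, (M.hasVertices_iff _ _).2 fun j => ?_, (N.equiv n).injective ?_⟩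
      · rw [Equiv.apply_symm_apply, hF]
      · rw [hφ, Equiv.apply_symm_apply, hF']

end NerveModel

/-! ### Cocycles and the totalization -/

section Cocycle

variable (G : Type u) [Group G] [DiffeologicalSpace G] (X : Type u) [DiffeologicalSpace X]

/-- A plot-indexed cocycle: smooth maps `g_f : U_p → G`, one for each map of plots `f : p → q`,
such that `g_{f' ∘ f}(u) = g_{f'}(f(u)) g_f(u)`. -/
structure Cocycle : Type u where
  toFun : ∀ {p q : Plot X}, (p ⟶ q) → SmoothMap p.dom.space G
  map_comp : ∀ {p q r : Plot X} (f : p ⟶ q) (f' : q ⟶ r) (x : p.dom.space),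
    toFun (f ≫ f') x = toFun f' (f.1.1 x) * toFun f x

variable {G X}

/-- A map of cocycles `g → g'`: smooth maps `h_p : U_p → G`, one for each plot `p`, such that
`h_q(f(u)) g_f(u) = g'_f(u) h_p(u)`. -/
structure Cocycle.Hom (g g' : Cocycle G X) : Type u where
  toFun : ∀ p : Plot X, SmoothMap p.dom.space G
  comm : ∀ {p q : Plot X} (f : p ⟶ q) (x : p.dom.space),
    toFun q (f.1.1 x) * g.toFun f x = g'.toFun f x * toFun p x

namespace Cocycle

theorem map_id (g : Cocycle G X) (p : Plot X) (x : p.dom.space) : g.toFun (𝟙 p) x = 1 := by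
  have h := g.map_comp (𝟙 p) (𝟙 p) x
  rw [Category.comp_id] at h
  exact left_eq_mul.1 h

@[ext]
theorem ext {g g' : Cocycle G X}
    (h : ∀ {p q : Plot X} (f : p ⟶ q) (x : p.dom.space), g.toFun f x = g'.toFun f x) : g = g' := by
  obtain ⟨g, hg⟩ := g
  obtain ⟨g', hg'⟩ := g'
  have e : @g = @g' := by
    funext p q f
    exact SmoothMap.ext fun x => h f x
  subst e
  rfl

theorem Hom.ext_apply {g g' : Cocycle G X} {h k : Hom g g'}
    (H : ∀ (p : Plot X) (x : p.dom.space), h.toFun p x = k.toFun p x) : h = k := by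
  obtain ⟨h, hh⟩ := h
  obtain ⟨k, hk⟩ := k
  have e : h = k := funext fun p => SmoothMap.ext fun x => H p x
  subst e
  rfl

variable [DiffeologicalGroup G]

/-- Cocycles and their maps form a category, with the pointwise product as composition. -/
instance : Category.{u} (Cocycle G X) where
  Hom := Cocycle.Hom
  id g := ⟨fun _ => 1, fun f x => (one_mul (g.toFun f x)).trans (mul_one (g.toFun f x)).symm⟩
  comp {g g' g''} h k := ⟨fun p => k.toFun p * h.toFun p, fun {p q} f x => by
    change k.toFun q (f.1.1 x) * h.toFun q (f.1.1 x) * g.toFun f x =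
      g''.toFun f x * (k.toFun p x * h.toFun p x)
    rw [mul_assoc, h.comm, ← mul_assoc, k.comm, mul_assoc]⟩
  id_comp h := Hom.ext_apply fun p x => mul_one (h.toFun p x)
  comp_id h := Hom.ext_apply fun p x => one_mul (h.toFun p x)
  assoc h k l := Hom.ext_apply fun p x =>
    (mul_assoc (l.toFun p x) (k.toFun p x) (h.toFun p x)).symm

theorem hom_ext {g g' : Cocycle G X} {h k : g ⟶ g'}
    (H : ∀ (p : Plot X) (x : p.dom.space), h.toFun p x = k.toFun p x) : h = k :=
  Hom.ext_apply H

theorem comp_toFun {g g' g'' : Cocycle G X} (h : g ⟶ g') (k : g' ⟶ g'') (p : Plot X)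
    (x : p.dom.space) : (h ≫ k).toFun p x = k.toFun p x * h.toFun p x := rfl

theorem eqToHom_toFun {g g' : Cocycle G X} (h : g = g') (p : Plot X) (x : p.dom.space) :
    (eqToHom h).toFun p x = 1 := by
  subst h
  rfl

/-- Functors to the category of cocycles agree when their values agree pointwise. -/
theorem functor_ext {J : Type v} [Category.{w} J] {F F' : J ⥤ Cocycle G X}
    (hobj : ∀ (j : J) {p q : Plot X} (f : p ⟶ q) (x : p.dom.space),
      (F.obj j).toFun f x = (F'.obj j).toFun f x)
    (hmap : ∀ {i j : J} (α : i ⟶ j) (p : Plot X) (x : p.dom.space),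
      (F.map α).toFun p x = (F'.map α).toFun p x) : F = F' :=
  CategoryTheory.Functor.ext (fun j => Cocycle.ext (hobj j)) fun i j α => hom_ext fun p x => by
    rw [comp_toFun, comp_toFun, eqToHom_toFun, eqToHom_toFun, one_mul, mul_one, hmap]

instance : Groupoid.{u} (Cocycle G X) where
  inv {g g'} h := ⟨fun p => (h.toFun p)⁻¹, fun {p q} f x => by
    change (h.toFun q (f.1.1 x))⁻¹ * g'.toFun f x = g.toFun f x * (h.toFun p x)⁻¹
    rw [inv_mul_eq_iff_eq_mul, ← mul_assoc, h.comm, mul_inv_cancel_right]⟩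
  inv_comp {g g'} h := hom_ext fun p x => mul_inv_cancel (h.toFun p x)
  comp_inv {g g'} h := hom_ext fun p x => inv_mul_cancel (h.toFun p x)

end Cocycle

end Cocycle

section Tot

variable {G : Type u} [Group G] [DiffeologicalSpace G] [DiffeologicalGroup G]
  {X : Type u} [DiffeologicalSpace X]

namespace Tot

/-- The value of a `k`-simplex `s : Δ^• × Δ^k → BG(QX)` of the totalization at the `n`-simplex
`(a, b)` of `Δ^m × Δ^k` and a chain `x` of length `m`, as a functor `[n] → C^∞(U_{p_m}, G)`. -/
def simplex {k m n : SimplexCategory} (s : (Tot (cosimplicialBGQ G X)).obj (op k))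
    (a : n ⟶ m) (b : n ⟶ k) (x : PlotChain X m) :
    Fin (n.len + 1) ⥤ SingleObj (SmoothMap x.source.space G) :=
  ((s.app m).app (op n) (stdSimplexProdMk a b)) x

theorem simplex_precomp {k m n n' : SimplexCategory}
    (s : (Tot (cosimplicialBGQ G X)).obj (op k))
    (c : n' ⟶ n) (a : n ⟶ m) (b : n ⟶ k) (x : PlotChain X m) :
    simplex s (c ≫ a) (c ≫ b) x =
      (SimplexCategory.toCat.map c).toFunctor ⋙ simplex s a b x :=
  congrFun (NatTrans.naturality_apply (s.app m) c.op (stdSimplexProdMk a b)) x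

theorem simplex_comp {k m m' n : SimplexCategory}
    (s : (Tot (cosimplicialBGQ G X)).obj (op k)) (θ : m ⟶ m')
    (a : n ⟶ m) (b : n ⟶ k) (x : PlotChain X m') :
    simplex s (a ≫ θ) b x = simplex s a b ((nerve (Plot X)).map θ.op x) ⋙
      SingleObj.mapHom _ _ (SmoothMap.pullback (PlotChain.sourceMap θ x).1
        (Cart.dSmooth (PlotChain.sourceMap θ x))) :=
  congrFun (ConcreteCategory.congr_hom (NatTrans.congr_app (s.naturality θ) (op n))
    (stdSimplexProdMk a b)) x

/-- For a `k`-simplex `s : Δ^• × Δ^k → BG(QX)` of the totalization, the label in `C^∞(U_{p_m}, G)`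
which `s` gives, at a chain `x` of length `m`, to the edge `(i, a) → (j, b)` of `Δ^m × Δ^k`. -/
def edge {k m : SimplexCategory} (s : (Tot (cosimplicialBGQ G X)).obj (op k))
    {i j : Fin (m.len + 1)} (hij : i ≤ j) {a b : Fin (k.len + 1)} (hab : a ≤ b)
    (x : PlotChain X m) : SmoothMap x.source.space G :=
  (simplex (n := ⦋1⦌) s (SimplexCategory.mkOfLe i j hij : ⦋1⦌ ⟶ ⦋m.len⦌)
    (SimplexCategory.mkOfLe a b hab : ⦋1⦌ ⟶ ⦋k.len⦌) x).map (homOfLE (Fin.zero_le 1))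

theorem simplex_map_eq_edge {k m n : SimplexCategory}
    (s : (Tot (cosimplicialBGQ G X)).obj (op k)) (a : n ⟶ m) (b : n ⟶ k) (x : PlotChain X m)
    {i j : Fin (n.len + 1)} (h : i ≤ j) :
    (simplex s a b x).map (homOfLE h) =
      edge s (a.toOrderHom.monotone h) (b.toOrderHom.monotone h) x := by
  have e := simplex_precomp s (n' := ⦋1⦌) (SimplexCategory.mkOfLe i j h : ⦋1⦌ ⟶ ⦋n.len⦌) a b x
  have ha : (SimplexCategory.mkOfLe i j h : ⦋1⦌ ⟶ ⦋n.len⦌) ≫ a =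
      (SimplexCategory.mkOfLe _ _ (a.toOrderHom.monotone h) : ⦋1⦌ ⟶ ⦋m.len⦌) := by
    ext t; fin_cases t <;> rfl
  have hb : (SimplexCategory.mkOfLe i j h : ⦋1⦌ ⟶ ⦋n.len⦌) ≫ b =
      (SimplexCategory.mkOfLe _ _ (b.toOrderHom.monotone h) : ⦋1⦌ ⟶ ⦋k.len⦌) := by
    ext t; fin_cases t <;> rfl
  rw [ha, hb] at e
  exact (congrArg (fun F : Fin 2 ⥤ SingleObj (SmoothMap x.source.space G) =>
    (F.map (homOfLE (Fin.zero_le 1)) : SmoothMap x.source.space G)) e).symm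

theorem cocycle_eq_edge (t : (Tot (cosimplicialBGQ G X)) _⦋0⦌) {p q : Plot X} (f : p ⟶ q) :
    Tot.cocycle t f = edge t (m := ⦋1⦌) (Fin.zero_le 1) (le_refl (0 : Fin 1))
      (ComposableArrows.mk₁ f) :=
  simplex_map_eq_edge t (n := ⦋1⦌) (𝟙 ⦋1⦌) (SimplexCategory.σ 0) (ComposableArrows.mk₁ f) _

theorem cocycleMap_eq_edge (s : (Tot (cosimplicialBGQ G X)) _⦋1⦌) (p : Plot X) :
    Tot.cocycleMap s p = edge s (m := ⦋0⦌) (le_refl (0 : Fin 1)) (Fin.zero_le (1 : Fin 2))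
      (ComposableArrows.mk₀ p) :=
  simplex_map_eq_edge s (n := ⦋1⦌) (SimplexCategory.σ 0) (𝟙 ⦋1⦌) (ComposableArrows.mk₀ p) _

section

variable {k m : SimplexCategory} (s : (Tot (cosimplicialBGQ G X)).obj (op k))

theorem edge_refl (i : Fin (m.len + 1)) (a : Fin (k.len + 1)) (x : PlotChain X m) :
    edge s (le_refl i) (le_refl a) x = 1 := by
  have e := simplex_map_eq_edge s (n := ⦋0⦌)
    (SimplexCategory.const ⦋0⦌ m i) (SimplexCategory.const ⦋0⦌ k a) x (le_refl (0 : Fin 1))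
  exact e.symm.trans (CategoryTheory.Functor.map_id
    (simplex s (SimplexCategory.const ⦋0⦌ m i) (SimplexCategory.const ⦋0⦌ k a) x) _)

theorem edge_trans {i j l : Fin (m.len + 1)} (hij : i ≤ j) (hjl : j ≤ l)
    {a b c : Fin (k.len + 1)} (hab : a ≤ b) (hbc : b ≤ c) (x : PlotChain X m) :
    edge s (hij.trans hjl) (hab.trans hbc) x = edge s hjl hbc x * edge s hij hab x := by
  let α : ⦋2⦌ ⟶ ⦋m.len⦌ := SimplexCategory.mkOfLeComp i j l hij hjl
  let β : ⦋2⦌ ⟶ ⦋k.len⦌ := SimplexCategory.mkOfLeComp a b c hab hbc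
  let F := simplex s (m := m) α β x
  have h01 := simplex_map_eq_edge s (m := m) α β x (i := (0 : Fin 3)) (j := (1 : Fin 3)) (by decide)
  have h12 := simplex_map_eq_edge s (m := m) α β x (i := (1 : Fin 3)) (j := (2 : Fin 3)) (by decide)
  have h02 := simplex_map_eq_edge s (m := m) α β x (i := (0 : Fin 3)) (j := (2 : Fin 3)) (by decide)
  refine h02.symm.trans (Eq.trans ?_ (congrArg₂ (· * ·) h12 h01))
  exact CategoryTheory.Functor.map_comp F (homOfLE (by decide : (0 : Fin 3) ≤ 1))
    (homOfLE (by decide : (1 : Fin 3) ≤ 2))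

theorem edge_comp {m' : SimplexCategory} (θ : m ⟶ m') {i j : Fin (m.len + 1)} (hij : i ≤ j)
    {a b : Fin (k.len + 1)} (hab : a ≤ b) (x : PlotChain X m') (u : x.source.space) :
    edge s (θ.toOrderHom.monotone hij) hab x u =
      edge s hij hab ((nerve (Plot X)).map θ.op x) ((PlotChain.sourceMap θ x).1 u) := by
  let α : ⦋1⦌ ⟶ ⦋m.len⦌ := SimplexCategory.mkOfLe i j hij
  let β : ⦋1⦌ ⟶ ⦋k.len⦌ := SimplexCategory.mkOfLe a b hab
  have e := simplex_comp s (m := m) θ α β x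
  have h := simplex_map_eq_edge s (n := ⦋1⦌) (α ≫ θ) β x (i := (0 : Fin 2)) (j := (1 : Fin 2))
    (by decide)
  rw [e] at h
  exact (congrArg (fun g : SmoothMap x.source.space G => g u) h).symm

theorem edge_map {k' : SimplexCategory} (c : k' ⟶ k) {i j : Fin (m.len + 1)} (hij : i ≤ j)
    {a b : Fin (k'.len + 1)} (hab : a ≤ b) (x : PlotChain X m) :
    edge ((Tot (cosimplicialBGQ G X)).map c.op s) hij hab x =
      edge s hij (c.toOrderHom.monotone hab) x :=
  simplex_map_eq_edge s (n := ⦋1⦌) (SimplexCategory.mkOfLe i j hij : ⦋1⦌ ⟶ ⦋m.len⦌)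
    ((SimplexCategory.mkOfLe a b hab : ⦋1⦌ ⟶ ⦋k'.len⦌) ≫ c) x _

end

section

variable {k : SimplexCategory} (s : (Tot (cosimplicialBGQ G X)).obj (op k))

theorem edge_eq_mk₁ {i j : Fin 2} (hij : i ≤ j) {a b : Fin (k.len + 1)} (hab : a ≤ b)
    (y : ComposableArrows (Plot X) 1) (u : (PlotChain.source (m := ⦋1⦌) y).space) :
    edge s (m := ⦋1⦌) hij hab y u =
      edge s (m := ⦋1⦌) hij hab (ComposableArrows.mk₁ y.hom) u := by
  obtain ⟨p, q, f, rfl⟩ := ComposableArrows.mk₁_surjective y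
  rfl

theorem edge_eq_mk₀ {i j : Fin 1} (hij : i ≤ j) {a b : Fin (k.len + 1)} (hab : a ≤ b)
    (y : ComposableArrows (Plot X) 0) (u : (PlotChain.source (m := ⦋0⦌) y).space) :
    edge s (m := ⦋0⦌) hij hab y u =
      edge s (m := ⦋0⦌) hij hab (ComposableArrows.mk₀ y.left) u := by
  obtain ⟨p, rfl⟩ := ComposableArrows.mk₀_surjective y
  rfl

/-- The edges of `Δ^m × {a}` are labelled by the cocycle at `a`. -/
theorem edge_horizontal {m : SimplexCategory} {i j : Fin (m.len + 1)} (hij : i ≤ j)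
    (a : Fin (k.len + 1)) (x : ComposableArrows (Plot X) m.len)
    (u : (PlotChain.source (m := m) x).space) :
    edge s hij (le_refl a) x u =
      edge s (m := ⦋1⦌) (Fin.zero_le 1) (le_refl a)
        (ComposableArrows.mk₁ (x.map (homOfLE hij))) ((x.map (homOfLE (Fin.zero_le i))).1.1 u) := by
  exact (edge_comp s (m := ⦋1⦌) (SimplexCategory.mkOfLe i j hij : ⦋1⦌ ⟶ ⦋m.len⦌)
    (i := (0 : Fin 2)) (j := (1 : Fin 2)) (Fin.zero_le 1) (le_refl a) x u).trans
    (edge_eq_mk₁ s _ _ _ _)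

/-- The edges of `{i} × Δ^k` are labelled by the maps of cocycles. -/
theorem edge_vertical {m : SimplexCategory} (i : Fin (m.len + 1))
    {a b : Fin (k.len + 1)} (hab : a ≤ b) (x : ComposableArrows (Plot X) m.len)
    (u : (PlotChain.source (m := m) x).space) :
    edge s (le_refl i) hab x u =
      edge s (m := ⦋0⦌) (le_refl (0 : Fin 1)) hab
        (ComposableArrows.mk₀ (x.obj i)) ((x.map (homOfLE (Fin.zero_le i))).1.1 u) :=
  (edge_comp s (m := ⦋0⦌) (SimplexCategory.const ⦋0⦌ m i) (le_refl (0 : Fin 1)) hab x u).trans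
    (edge_eq_mk₀ s _ _ _ _)

/-- Every label of a `k`-simplex of the totalization is a product of a label of the cocycle and
a label of the map of cocycles. -/
theorem edge_eq_mul {m : SimplexCategory} {i j : Fin (m.len + 1)} (hij : i ≤ j)
    {a b : Fin (k.len + 1)} (hab : a ≤ b) (x : ComposableArrows (Plot X) m.len)
    (u : (PlotChain.source (m := m) x).space) :
    edge s hij hab x u =
      edge s (m := ⦋0⦌) (le_refl (0 : Fin 1)) hab
        (ComposableArrows.mk₀ (x.obj j)) ((x.map (homOfLE (Fin.zero_le j))).1.1 u) *
      edge s (m := ⦋1⦌) (Fin.zero_le 1) (le_refl a)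
        (ComposableArrows.mk₁ (x.map (homOfLE hij))) ((x.map (homOfLE (Fin.zero_le i))).1.1 u) := by
  rw [← edge_horizontal s hij a x u, ← edge_vertical s j hab x u]
  exact congrArg (fun g : SmoothMap _ G => g u) (edge_trans s hij (le_refl j) (le_refl a) hab x)

/-- The `k`-simplex of the nerve of the category of cocycles associated with a `k`-simplex of the
totalization. -/
def toCocycles : Fin (k.len + 1) ⥤ Cocycle G X where
  obj a :=
    { toFun := fun f => edge s (m := ⦋1⦌) (Fin.zero_le 1) (le_refl a) (ComposableArrows.mk₁ f)
      map_comp := fun {p q r} f f' x => by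
        have h := edge_trans s (m := ⦋2⦌) (i := (0 : Fin 3)) (j := (1 : Fin 3)) (l := (2 : Fin 3))
          (by decide) (by decide) (le_refl a) (le_refl a) (ComposableArrows.mk₂ f f')
        have h' := congrArg (fun g : SmoothMap p.dom.space G => g x) h
        refine Eq.trans ?_ (h'.trans (congrArg₂ (· * ·) ?_ ?_))
        · exact (edge_horizontal s (m := ⦋2⦌) (i := (0 : Fin 3)) (j := (2 : Fin 3)) (by decide) a
            (ComposableArrows.mk₂ f f') x).symm
        · exact edge_horizontal s (m := ⦋2⦌) (i := (1 : Fin 3)) (j := (2 : Fin 3)) (by decide) a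
            (ComposableArrows.mk₂ f f') x
        · exact edge_horizontal s (m := ⦋2⦌) (i := (0 : Fin 3)) (j := (1 : Fin 3)) (by decide) a
            (ComposableArrows.mk₂ f f') x }
  map {a b} hab :=
    { toFun := fun p => edge s (m := ⦋0⦌) (le_refl (0 : Fin 1)) (leOfHom hab)
        (ComposableArrows.mk₀ p)
      comm := fun {p q} f x => by
        have h := edge_eq_mul s (m := ⦋1⦌) (i := (0 : Fin 2)) (j := (1 : Fin 2)) (by decide)
          (leOfHom hab) (ComposableArrows.mk₁ f) x
        refine h.symm.trans ?_
        have h' := edge_trans s (m := ⦋1⦌) (i := (0 : Fin 2)) (j := (0 : Fin 2))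
          (l := (1 : Fin 2)) (by decide) (by decide) (leOfHom hab) (le_refl b)
          (ComposableArrows.mk₁ f)
        refine (congrArg (fun g : SmoothMap p.dom.space G => g x) h').trans
          (congrArg (edge s (m := ⦋1⦌) (i := (0 : Fin 2)) (j := (1 : Fin 2)) (by decide)
          (le_refl b) (ComposableArrows.mk₁ f) x * ·) ?_)
        exact edge_vertical s (m := ⦋1⦌) (0 : Fin 2) (leOfHom hab) (ComposableArrows.mk₁ f) x }
  map_id a := Cocycle.hom_ext fun p x => congrArg (fun g : SmoothMap p.dom.space G => g x)
    (edge_refl s (m := ⦋0⦌) (0 : Fin 1) a (ComposableArrows.mk₀ p))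
  map_comp {a b c} hab hbc := Cocycle.hom_ext fun p x =>
    congrArg (fun g : SmoothMap p.dom.space G => g x)
      (edge_trans s (m := ⦋0⦌) (le_refl (0 : Fin 1)) (le_refl (0 : Fin 1)) (leOfHom hab)
        (leOfHom hbc) (ComposableArrows.mk₀ p))

end

theorem singleObj_functor_ext {J : Type v} [Category.{w} J] {M : Type u} [Monoid M]
    {F F' : J ⥤ SingleObj M} (h : ∀ {i j : J} (α : i ⟶ j), (F.map α : M) = F'.map α) : F = F' :=
  Functor.hext (fun _ => rfl) fun _ _ α => heq_of_eq (h α)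

theorem toCocycles_injective (k : SimplexCategory) :
    Function.Injective fun s : (Tot (cosimplicialBGQ G X)).obj (op k) => toCocycles s := by
  intro s s' h
  have hg : ∀ (a : Fin (k.len + 1)) {p q : Plot X} (f : p ⟶ q) (x : p.dom.space),
      ((toCocycles s).obj a).toFun f x = ((toCocycles s').obj a).toFun f x := by
    intro a p q f x
    exact congrArg (fun F : Fin (k.len + 1) ⥤ Cocycle G X => (F.obj a).toFun f x) h
  have hh : ∀ {a b : Fin (k.len + 1)} (hab : a ⟶ b) (p : Plot X) (x : p.dom.space),
      ((toCocycles s).map hab).toFun p x = ((toCocycles s').map hab).toFun p x := by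
    intro a b hab p x
    exact congrArg (fun F : Fin (k.len + 1) ⥤ Cocycle G X => (F.map hab).toFun p x) h
  refine NatTrans.ext (funext fun m => SSet.hom_ext fun n => ?_)
  ext z
  obtain ⟨n⟩ := n
  obtain ⟨⟨z₁⟩, ⟨z₂⟩⟩ := z
  funext x
  refine singleObj_functor_ext (F := simplex s z₁ z₂ x) (F' := simplex s' z₁ z₂ x) fun {i j} α => ?_
  have hα : α = homOfLE (leOfHom α) := rfl
  rw [hα, simplex_map_eq_edge, simplex_map_eq_edge]
  refine SmoothMap.ext fun u => ?_
  exact (edge_eq_mul s _ _ x u).trans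
    ((congrArg₂ (· * ·) (hh (homOfLE (z₂.toOrderHom.monotone (leOfHom α))) _ _)
      (hg _ _ _)).trans (edge_eq_mul s' _ _ x u).symm)

section

variable {k m : SimplexCategory} (F : Fin (k.len + 1) ⥤ Cocycle G X)
  (x : ComposableArrows (Plot X) m.len)

/-- The label in `C^∞(U_{p_m}, G)` which a `k`-simplex `F` of the nerve of the category of cocycles
gives, at a chain `x` of length `m`, to the edge `(i, a) → (j, b)` of `Δ^m × Δ^k`: the product of
the label of `(i, a) → (j, a)` by the cocycle and of `(j, a) → (j, b)` by the map of cocycles. -/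
def label {i j : Fin (m.len + 1)} (hij : i ≤ j) {a b : Fin (k.len + 1)} (hab : a ≤ b) :
    SmoothMap (PlotChain.source (m := m) x).space G :=
  SmoothMap.pullback (x.map (homOfLE (Fin.zero_le j))).1.1 (Cart.dSmooth _)
      ((F.map (homOfLE hab)).toFun (x.obj j)) *
    SmoothMap.pullback (x.map (homOfLE (Fin.zero_le i))).1.1 (Cart.dSmooth _)
      ((F.obj a).toFun (x.map (homOfLE hij)))

theorem label_apply {i j : Fin (m.len + 1)} (hij : i ≤ j) {a b : Fin (k.len + 1)} (hab : a ≤ b)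
    (u : (PlotChain.source (m := m) x).space) :
    label F x hij hab u =
      (F.map (homOfLE hab)).toFun (x.obj j) ((x.map (homOfLE (Fin.zero_le j))).1.1 u) *
      (F.obj a).toFun (x.map (homOfLE hij)) ((x.map (homOfLE (Fin.zero_le i))).1.1 u) := rfl

theorem chain_map_trans {i j : Fin (m.len + 1)} (hij : i ≤ j)
    (u : (PlotChain.source (m := m) x).space) :
    (x.map (homOfLE (Fin.zero_le j))).1.1 u =
      (x.map (homOfLE hij)).1.1 ((x.map (homOfLE (Fin.zero_le i))).1.1 u) := by
  have h := x.map_comp (homOfLE (Fin.zero_le i)) (homOfLE hij)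
  exact congrArg (fun f : x.obj 0 ⟶ x.obj j => f.1.1 u) h

theorem label_refl (i : Fin (m.len + 1)) (a : Fin (k.len + 1)) :
    label F x (le_refl i) (le_refl a) = 1 := by
  refine SmoothMap.ext fun u => ?_
  have h₁ : F.map (homOfLE (le_refl a)) = 𝟙 _ := F.map_id a
  have h₂ : x.map (homOfLE (le_refl i)) = 𝟙 _ := x.map_id i
  rw [label_apply, h₁, h₂, Cocycle.map_id]
  exact mul_one _

theorem label_trans {i j l : Fin (m.len + 1)} (hij : i ≤ j) (hjl : j ≤ l)
    {a b c : Fin (k.len + 1)} (hab : a ≤ b) (hbc : b ≤ c) :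
    label F x (hij.trans hjl) (hab.trans hbc) = label F x hjl hbc * label F x hij hab := by
  refine SmoothMap.ext fun u => ?_
  change _ = label F x hjl hbc u * label F x hij hab u
  have h₁ : F.map (homOfLE (hab.trans hbc)) = F.map (homOfLE hab) ≫ F.map (homOfLE hbc) :=
    F.map_comp (homOfLE hab) (homOfLE hbc)
  have h₂ : x.map (homOfLE (hij.trans hjl)) = x.map (homOfLE hij) ≫ x.map (homOfLE hjl) :=
    x.map_comp (homOfLE hij) (homOfLE hjl)
  have h₃ := (F.map (homOfLE hab)).comm (x.map (homOfLE hjl))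
    ((x.map (homOfLE (Fin.zero_le j))).1.1 u)
  rw [← chain_map_trans x hjl] at h₃
  rw [label_apply, label_apply, label_apply, h₁, h₂, Cocycle.map_comp, Cocycle.comp_toFun,
    ← chain_map_trans x hij, mul_assoc, mul_assoc]
  congr 1
  rw [← mul_assoc, h₃, mul_assoc]

theorem label_comp {m' : SimplexCategory} (θ : m' ⟶ m) {i j : Fin (m'.len + 1)} (hij : i ≤ j)
    {a b : Fin (k.len + 1)} (hab : a ≤ b) (u : (PlotChain.source (m := m) x).space) :
    label F x (θ.toOrderHom.monotone hij) hab u =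
      label F (m := m') ((nerve (Plot X)).map θ.op x) hij hab
        ((PlotChain.sourceMap θ x).1 u) := by
  rw [label_apply, chain_map_trans x (θ.toOrderHom.monotone (Fin.zero_le j)),
    chain_map_trans x (θ.toOrderHom.monotone (Fin.zero_le i))]
  rfl

end

/-- The `k`-simplex of the totalization given by a `k`-simplex of the nerve of the category of
cocycles. -/
def ofCocycles {k : SimplexCategory} (F : Fin (k.len + 1) ⥤ Cocycle G X) :
    (Tot (cosimplicialBGQ G X)).obj (op k) where
  app m :=
    { app := fun n => ↾fun z x =>
        { obj := fun _ => SingleObj.star _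
          map := fun {i j} h => label F x (z.1.down.toOrderHom.monotone (leOfHom h))
            (z.2.down.toOrderHom.monotone (leOfHom h))
          map_id := fun i => label_refl F x _ _
          map_comp := fun {i j l} h h' => label_trans F x _ _ _ _ }
      naturality := fun n n' c => by
        ext z
        obtain ⟨⟨a⟩, ⟨b⟩⟩ := z
        rfl }
  naturality m m' θ := by
    refine SSet.hom_ext fun n => ?_
    ext z
    obtain ⟨⟨a⟩, ⟨b⟩⟩ := z
    funext x
    refine singleObj_functor_ext fun {i j} h => ?_
    refine SmoothMap.ext fun u => ?_
    exact label_comp F x θ (a.toOrderHom.monotone (leOfHom h))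
      (b.toOrderHom.monotone (leOfHom h)) u

theorem toCocycles_ofCocycles {k : SimplexCategory} (F : Fin (k.len + 1) ⥤ Cocycle G X) :
    toCocycles (ofCocycles F) = F := by
  refine Cocycle.functor_ext (fun a p q f x => ?_) fun {a b} h p x => ?_
  · refine (label_apply F (m := ⦋1⦌) (ComposableArrows.mk₁ f) (i := (0 : Fin 2))
      (j := (1 : Fin 2)) (Fin.zero_le 1) (le_refl a) x).trans ?_
    have h₁ : F.map (homOfLE (le_refl a)) = 𝟙 _ := F.map_id a
    rw [h₁]
    exact one_mul _
  · refine (label_apply F (m := ⦋0⦌) (ComposableArrows.mk₀ p) (i := (0 : Fin 1))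
      (j := (0 : Fin 1)) (le_refl 0) (leOfHom h) x).trans ?_
    have h₁ : (ComposableArrows.mk₀ p).map (homOfLE (le_refl (0 : Fin 1))) = 𝟙 p :=
      (ComposableArrows.mk₀ p).map_id _
    refine (congrArg _ ((F.obj a).map_id p x)).trans (mul_one _)

/-- The `k`-simplices of the totalization of `BG(QX)` are the `k`-simplices of the nerve of the
category of cocycles. -/
def equivCocycles (k : SimplexCategory) :
    (Tot (cosimplicialBGQ G X)).obj (op k) ≃ (Fin (k.len + 1) ⥤ Cocycle G X) where
  toFun := toCocycles
  invFun := ofCocycles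
  left_inv s := toCocycles_injective k (toCocycles_ofCocycles (toCocycles s))
  right_inv := toCocycles_ofCocycles

theorem toCocycles_map {k k' : SimplexCategory} (c : k' ⟶ k)
    (s : (Tot (cosimplicialBGQ G X)).obj (op k)) :
    toCocycles ((Tot (cosimplicialBGQ G X)).map c.op s) =
      (SimplexCategory.toCat.map c).toFunctor ⋙ toCocycles s :=
  Cocycle.functor_ext
    (fun a p _ f x => congrArg (fun g : SmoothMap p.dom.space G => g x)
      (edge_map s (m := ⦋1⦌) c (Fin.zero_le 1) (le_refl a) (ComposableArrows.mk₁ f)))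
    fun h p x => congrArg (fun g : SmoothMap p.dom.space G => g x)
      (edge_map s (m := ⦋0⦌) c (le_refl (0 : Fin 1)) (leOfHom h) (ComposableArrows.mk₀ p))

/-- The cocycle of a vertex of the totalization. -/
def cocycleObj (t : (Tot (cosimplicialBGQ G X)) _⦋0⦌) : Cocycle G X where
  toFun := Tot.cocycle t
  map_comp f f' x := by
    rw [cocycle_eq_edge, cocycle_eq_edge, cocycle_eq_edge]
    exact ((toCocycles t).obj 0).map_comp f f' x

theorem toCocycles_zero (t : (Tot (cosimplicialBGQ G X)) _⦋0⦌) :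
    toCocycles t = ComposableArrows.mk₀ (cocycleObj t) := by
  refine Cocycle.functor_ext (fun a p q f x => ?_) fun {a b} h p x => ?_
  · obtain rfl := Subsingleton.elim (0 : Fin 1) a
    exact congrArg (fun g : SmoothMap p.dom.space G => g x) (cocycle_eq_edge t f).symm
  · obtain rfl := Subsingleton.elim (0 : Fin 1) a
    obtain rfl := Subsingleton.elim (0 : Fin 1) b
    exact congrArg (fun F : (toCocycles t).obj 0 ⟶ (toCocycles t).obj 0 => F.toFun p x)
      ((toCocycles t).map_id 0)

theorem cocycleObj_δ_one (s : (Tot (cosimplicialBGQ G X)) _⦋1⦌) {p q : Plot X} (f : p ⟶ q)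
    (x : p.dom.space) : (cocycleObj ((Tot (cosimplicialBGQ G X)).δ 1 s)).toFun f x =
      ((toCocycles s).obj (0 : Fin 2)).toFun f x :=
  congrArg (fun g : SmoothMap p.dom.space G => g x) ((cocycle_eq_edge _ f).trans
    (edge_map s (m := ⦋1⦌) (SimplexCategory.δ 1) (Fin.zero_le 1) (le_refl (0 : Fin 1))
      (ComposableArrows.mk₁ f)))

theorem cocycleObj_δ_zero (s : (Tot (cosimplicialBGQ G X)) _⦋1⦌) {p q : Plot X} (f : p ⟶ q)
    (x : p.dom.space) : (cocycleObj ((Tot (cosimplicialBGQ G X)).δ 0 s)).toFun f x =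
      ((toCocycles s).obj (1 : Fin 2)).toFun f x :=
  congrArg (fun g : SmoothMap p.dom.space G => g x) ((cocycle_eq_edge _ f).trans
    (edge_map s (m := ⦋1⦌) (SimplexCategory.δ 0) (Fin.zero_le 1) (le_refl (0 : Fin 1))
      (ComposableArrows.mk₁ f)))

/-- The map of cocycles of a 1-simplex of the totalization. -/
def cocycleHom (s : (Tot (cosimplicialBGQ G X)) _⦋1⦌) :
    cocycleObj ((Tot (cosimplicialBGQ G X)).δ 1 s) ⟶
      cocycleObj ((Tot (cosimplicialBGQ G X)).δ 0 s) where
  toFun := Tot.cocycleMap s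
  comm {p q} f x := by
    rw [cocycleObj_δ_one, cocycleObj_δ_zero, cocycleMap_eq_edge, cocycleMap_eq_edge]
    exact ((toCocycles s).map (homOfLE (Fin.zero_le (1 : Fin 2)))).comm f x

theorem toCocycles_one (s : (Tot (cosimplicialBGQ G X)) _⦋1⦌) :
    toCocycles s = ComposableArrows.mk₁ (cocycleHom s) := by
  have hid : ∀ (F : Fin 2 ⥤ Cocycle G X) (a : Fin 2) (h : a ⟶ a) (p : Plot X) (x : p.dom.space),
      (F.map h).toFun p x = 1 := fun F a h p x =>
    congrArg (fun k : F.obj a ⟶ F.obj a => k.toFun p x) (F.map_id a)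
  refine Cocycle.functor_ext (fun a p q f x => ?_) fun {a b} h p x => ?_
  · match a with
    | 0 => exact (cocycleObj_δ_one s f x).symm
    | 1 => exact (cocycleObj_δ_zero s f x).symm
  · match a, b, h with
    | 0, 0, h => exact (hid _ _ _ p x).trans (hid _ _ _ p x).symm
    | 1, 1, h => exact (hid _ _ _ p x).trans (hid _ _ _ p x).symm
    | 0, 1, h =>
      exact congrArg (fun g : SmoothMap p.dom.space G => g x) (cocycleMap_eq_edge s p).symm
    | 1, 0, h => exact absurd (leOfHom h) (by decide)

end Tot

end Tot

/-! ### The bundle glued from a cocycle -/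

section Group

variable {G : Type u} [Group G] [DiffeologicalSpace G] [DiffeologicalGroup G] {n : ℕ}
  {f g : EuclideanSpace ℝ (Fin n) → G}

theorem IsPlot.mul (hf : IsPlot f) (hg : IsPlot g) : IsPlot fun x => f x * g x :=
  DiffeologicalGroup.dSmooth_mul n (fun x => (f x, g x)) ⟨hf, hg⟩

theorem IsPlot.inv (hf : IsPlot f) : IsPlot fun x => (f x)⁻¹ :=
  DiffeologicalGroup.dSmooth_inv n f hf

end Group

section Glue

variable {G : Type u} [Group G] [DiffeologicalSpace G] {X : Type u} [DiffeologicalSpace X]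

/-- The plot `ℝ⁰ → X` with value `x`. -/
def Plot.point (x : X) : Plot X := ⟨⟨0⟩, fun _ => x, isPlot_const⟩

/-- The map of plots from the point `x` to a plot `p` which picks a preimage `u` of `x`. -/
def Plot.pointHom {x : X} (p : Plot X) (u : p.dom.space) (h : p.toFun u = x) : Plot.point x ⟶ p :=
  ⟨⟨fun _ => u, contDiff_const⟩, funext fun _ => h⟩

/-- The composite of a plot with a smooth map. -/
def Plot.reparam (p : Plot X) {n : ℕ} (f : EuclideanSpace ℝ (Fin n) → p.dom.space)
    (hf : ContDiff ℝ ∞ f) : Plot X := ⟨⟨n⟩, p.toFun ∘ f, isPlot_reparam p.isPlot hf⟩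

/-- The smooth map `f`, as a map of plots `p ∘ f → p`. -/
def Plot.reparamHom (p : Plot X) {n : ℕ} (f : EuclideanSpace ℝ (Fin n) → p.dom.space)
    (hf : ContDiff ℝ ∞ f) : p.reparam f hf ⟶ p := ⟨⟨f, hf⟩, rfl⟩

namespace Cocycle

variable (c : Cocycle G X)

/-- The value of a cocycle `{g_f}` at the map from the point `p(u)` to the plot `p` which picks
`u`. -/
def pointValue (p : Plot X) (u : p.dom.space) : G := c.toFun (p.pointHom u rfl) 0

theorem toFun_pointHom {x : X} (p : Plot X) (u : p.dom.space) (h : p.toFun u = x) :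
    c.toFun (p.pointHom u h) 0 = c.pointValue p u := by
  subst h
  rfl

theorem pointValue_map {p q : Plot X} (f : p ⟶ q) (u : p.dom.space) :
    c.pointValue q (f.1.1 u) = c.toFun f u * c.pointValue p u := by
  have h : q.toFun (f.1.1 u) = p.toFun u := congrFun f.2 u
  rw [← c.toFun_pointHom q _ h]
  exact c.map_comp (p.pointHom u rfl) f 0

/-- The bundle `P_g` glued from a cocycle `g`. -/
abbrev bundle : BundleData G X := gluedBundle c.toFun

/-- The point `[p, u, h]` of the bundle glued from a cocycle. -/
abbrev pt (p : Plot X) (u : p.dom.space) (h : G) : c.bundle.carrier := gluedBundle.mk c.toFun p u h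

theorem pt_map {p q : Plot X} (f : p ⟶ q) (u : p.dom.space) (h : G) :
    c.pt p u h = c.pt q (f.1.1 u) (c.toFun f u * h) := Quot.sound ⟨f, rfl, rfl⟩

theorem exists_eq_pt (a : c.bundle.carrier) : ∃ p u h, a = c.pt p u h := by
  obtain ⟨⟨p, u, h⟩, rfl⟩ := Quot.mk_surjective a
  exact ⟨p, u, h, rfl⟩

theorem act_pt (p : Plot X) (u : p.dom.space) (h k : G) :
    c.bundle.act (c.pt p u h) k = c.pt p u (h * k) := rfl

/-- The coordinate of a point of the glued bundle with respect to the point `[x, 0, 1]` of its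
fibre. Together with the projection it identifies the set underlying the bundle with `X × G`. -/
def coord : c.bundle.carrier → G :=
  Quot.lift (fun a => (c.pointValue a.1 a.2.1)⁻¹ * a.2.2) (by
    rintro ⟨p, u, h⟩ ⟨q, v, k⟩ ⟨f, hv, hk⟩
    dsimp only at f hv hk ⊢
    rw [hv, hk, c.pointValue_map, mul_inv_rev, mul_assoc, inv_mul_cancel_left])

theorem coord_pt (p : Plot X) (u : p.dom.space) (h : G) :
    c.coord (c.pt p u h) = (c.pointValue p u)⁻¹ * h := rfl

theorem coord_act (a : c.bundle.carrier) (k : G) :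
    c.coord (c.bundle.act a k) = c.coord a * k := by
  obtain ⟨p, u, h, rfl⟩ := c.exists_eq_pt a
  rw [act_pt, coord_pt, coord_pt, mul_assoc]

theorem pt_point {x : X} (p : Plot X) (u : p.dom.space) (h : p.toFun u = x) (k : G) :
    c.pt (Plot.point x) 0 k = c.pt p u (c.pointValue p u * k) := by
  rw [← c.toFun_pointHom p u h]
  exact c.pt_map (p.pointHom u h) 0 k

theorem eq_pt (a : c.bundle.carrier) (p : Plot X) (u : p.dom.space)
    (h : c.bundle.proj a = p.toFun u) : a = c.pt p u (c.pointValue p u * c.coord a) := by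
  obtain ⟨q, v, k, rfl⟩ := c.exists_eq_pt a
  rw [← c.pt_point p u rfl, c.pt_point q v h, coord_pt, mul_inv_cancel_left]

theorem pt_injective (p : Plot X) (u : p.dom.space) : Function.Injective (c.pt p u) :=
  fun h k e => by
    have := congrArg c.coord e
    rwa [coord_pt, coord_pt, mul_right_inj] at this

theorem isPlot_pt (p : Plot X) {n : ℕ} {f : EuclideanSpace ℝ (Fin n) → p.dom.space}
    (hf : ContDiff ℝ ∞ f) {h : EuclideanSpace ℝ (Fin n) → G} (hh : IsPlot h) :
    IsPlot fun u => c.pt p (f u) (h u) := by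
  have hs : IsPlot fun u => (⟨p, f u, h u⟩ : Σ p : Plot X, p.dom.space × G) := by
    refine DiffeologicalSpace.le_iff'.1 (le_iSup (fun p : Plot X => pushforwardDiffeology
      (Sigma.mk p) (inferInstance : DiffeologicalSpace (p.dom.space × G))) p) n _ ?_
    exact DiffeologicalSpace.isPlot_generatedFrom_of_mem ⟨fun u => (f u, h u), ⟨hf.isPlot, hh⟩, rfl⟩
  exact DiffeologicalSpace.isPlot_generatedFrom_of_mem ⟨_, hs, rfl⟩

/-- The condition on a parametrization `r` of the glued bundle that its projection `p` to `X` is a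
plot, and `r(u) = [p, u, h(u)]` for a smooth map `h`. -/
def IsPlotOfBundle {n : ℕ} (r : EuclideanSpace ℝ (Fin n) → c.bundle.carrier) : Prop :=
  ∃ hp : IsPlot (c.bundle.proj ∘ r),
    IsPlot fun u => c.pointValue ⟨⟨n⟩, c.bundle.proj ∘ r, hp⟩ u * c.coord (r u)

theorem IsPlotOfBundle.eq_pt {c : Cocycle G X} {n : ℕ}
    {r : EuclideanSpace ℝ (Fin n) → c.bundle.carrier} (hr : c.IsPlotOfBundle r) :
    ∃ (hp : IsPlot (c.bundle.proj ∘ r)) (h : EuclideanSpace ℝ (Fin n) → G), IsPlot h ∧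
      ∀ u, r u = c.pt ⟨⟨n⟩, c.bundle.proj ∘ r, hp⟩ u (h u) := by
  obtain ⟨hp, hh⟩ := hr
  exact ⟨hp, _, hh, fun u => c.eq_pt (r u) ⟨⟨n⟩, c.bundle.proj ∘ r, hp⟩ u rfl⟩

variable [DiffeologicalGroup G]

theorem isPlotOfBundle_pt (p : Plot X) {n : ℕ} {f : EuclideanSpace ℝ (Fin n) → p.dom.space}
    (hf : ContDiff ℝ ∞ f) {h : EuclideanSpace ℝ (Fin n) → G} (hh : IsPlot h) :
    c.IsPlotOfBundle fun u => c.pt p (f u) (h u) := by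
  refine ⟨(p.reparam f hf).isPlot, ?_⟩
  have : (fun u => c.pointValue (p.reparam f hf) u * c.coord (c.pt p (f u) (h u))) =
      fun u => (c.toFun (p.reparamHom f hf) u)⁻¹ * h u := by
    funext u
    have e := c.pointValue_map (p.reparamHom f hf) u
    change c.pointValue p (f u) = _ at e
    rw [coord_pt, e, mul_inv_rev, mul_assoc, mul_inv_cancel_left]
  refine Eq.mpr (congrArg IsPlot this) (IsPlot.mul (IsPlot.inv ?_) hh)
  exact (c.toFun (p.reparamHom f hf)).2.isPlot

theorem IsPlotOfBundle.reparam {c : Cocycle G X} {n m : ℕ}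
    {r : EuclideanSpace ℝ (Fin n) → c.bundle.carrier} (hr : c.IsPlotOfBundle r)
    {f : EuclideanSpace ℝ (Fin m) → EuclideanSpace ℝ (Fin n)} (hf : ContDiff ℝ ∞ f) :
    c.IsPlotOfBundle (r ∘ f) := by
  obtain ⟨hp, h, hh, e⟩ := hr.eq_pt
  have := c.isPlotOfBundle_pt ⟨⟨n⟩, c.bundle.proj ∘ r, hp⟩ hf (isPlot_reparam hh hf)
  rwa [show r ∘ f = _ from funext fun u => e (f u)]

/-- The parametrizations in `IsPlotOfBundle` form a diffeology. -/
abbrev bundleDiffeology : DiffeologicalSpace c.bundle.carrier where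
  plots n := {r | c.IsPlotOfBundle r}
  constant_plots {n} a := by
    obtain ⟨p, u, h, rfl⟩ := c.exists_eq_pt a
    exact c.isPlotOfBundle_pt p (contDiff_const (c := u)) (isPlot_const (x := h))
  plot_reparam hr hf := hr.reparam hf
  locality {n r} hr := by
    have hp : IsPlot (c.bundle.proj ∘ r) := DiffeologicalSpace.locality fun x => by
      obtain ⟨V, hV, hx, h⟩ := hr x
      exact ⟨V, hV, hx, fun hfV hf => (h hfV hf).1⟩
    refine ⟨hp, DiffeologicalSpace.locality fun x => ?_⟩
    obtain ⟨V, hV, hx, h⟩ := hr x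
    refine ⟨V, hV, hx, fun {m f} hfV hf => ?_⟩
    obtain ⟨hp', hh⟩ := h hfV hf
    let p : Plot X := ⟨⟨n⟩, c.bundle.proj ∘ r, hp⟩
    have e : (fun u => c.pointValue p u * c.coord (r u)) ∘ f = fun u =>
        c.toFun (p.reparamHom f hf) u * (c.pointValue (p.reparam f hf) u * c.coord (r (f u))) := by
      funext u
      exact (congrArg (· * c.coord (r (f u))) (c.pointValue_map (p.reparamHom f hf) u)).trans
        (mul_assoc _ _ _)
    rw [e]
    exact IsPlot.mul (c.toFun (p.reparamHom f hf)).2.isPlot hh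

/-- The quotient diffeology of the glued bundle. -/
theorem isPlot_iff_isPlotOfBundle {n : ℕ} {r : EuclideanSpace ℝ (Fin n) → c.bundle.carrier} :
    IsPlot r ↔ c.IsPlotOfBundle r := by
  refine ⟨fun hr => ?_, fun hr => ?_⟩
  · have hsum : (instDiffeologicalSpaceSigma : DiffeologicalSpace (Σ p : Plot X, p.dom.space × G)) ≤
        pullbackDiffeology (Quot.mk (GlueRel c.toFun)) c.bundleDiffeology := by
      refine iSup_le fun p => DiffeologicalSpace.generateFrom_le_iff.2 ?_
      rintro n s ⟨t, ht, e⟩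
      have := c.isPlotOfBundle_pt p (f := fun u => (t u).1) ht.1.contDiff ht.2
      have e : s = fun u => ⟨p, t u⟩ := e
      rw [e]
      exact this
    have hquot : c.bundle.diffeology ≤ c.bundleDiffeology := by
      refine DiffeologicalSpace.generateFrom_le_iff.2 ?_
      rintro n s ⟨t, ht, e⟩
      have := DiffeologicalSpace.le_iff'.1 hsum _ _ ht
      have e : s = fun u => Quot.mk _ (t u) := e
      rw [e]
      exact this
    exact DiffeologicalSpace.le_iff'.1 hquot n r hr
  · obtain ⟨hp, h, hh, e⟩ := hr.eq_pt
    rw [show r = _ from funext e]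
    exact c.isPlot_pt ⟨⟨n⟩, c.bundle.proj ∘ r, hp⟩ contDiff_id hh

/-- A plot of the glued bundle over a plot `p` of `X` is of the form `[p, u, h(u)]` for a smooth map
`h`. -/
theorem isPlot_pointValue_mul_coord (p : Plot X) {r : p.dom.space → c.bundle.carrier}
    (hr : IsPlot r) (h : ∀ u, c.bundle.proj (r u) = p.toFun u) :
    IsPlot fun u => c.pointValue p u * c.coord (r u) := by
  obtain ⟨⟨n⟩, p, hp⟩ := p
  change EuclideanSpace ℝ (Fin n) → c.bundle.carrier at r
  obtain rfl : c.bundle.proj ∘ r = p := funext h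
  exact (c.isPlot_iff_isPlotOfBundle.1 hr).2

end Cocycle

end Glue

/-! ### Cocycles and principal bundles are equivalent -/

section Bundle

variable {G : Type u} [Group G] [DiffeologicalSpace G] {X : Type u} [DiffeologicalSpace X]

namespace Cocycle

variable (c : Cocycle G X)

theorem act_one (a : c.bundle.carrier) : c.bundle.act a 1 = a := by
  obtain ⟨p, u, h, rfl⟩ := c.exists_eq_pt a
  rw [act_pt, mul_one]

theorem act_mul (a : c.bundle.carrier) (g h : G) :
    c.bundle.act a (g * h) = c.bundle.act (c.bundle.act a g) h := by
  obtain ⟨p, u, k, rfl⟩ := c.exists_eq_pt a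
  rw [act_pt, act_pt, act_pt, mul_assoc]

theorem proj_act (a : c.bundle.carrier) (g : G) :
    c.bundle.proj (c.bundle.act a g) = c.bundle.proj a := by
  obtain ⟨p, u, k, rfl⟩ := c.exists_eq_pt a
  rfl

theorem act_inv_coord_mul_coord {a b : c.bundle.carrier} (h : c.bundle.proj a = c.bundle.proj b) :
    c.bundle.act a ((c.coord a)⁻¹ * c.coord b) = b := by
  have e := c.eq_pt (c.bundle.act a ((c.coord a)⁻¹ * c.coord b)) (Plot.point (c.bundle.proj b)) 0
    ((c.proj_act a _).trans h)
  rwa [coord_act, mul_inv_cancel_left, ← c.eq_pt b _ 0 rfl] at e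

/-- The map of bundles `[p, u, k] ↦ [p, u, h_p(u) k]` of a map of cocycles `{h_p}`. -/
def Hom.bundleMap {c c' : Cocycle G X} (η : c.Hom c') : c.bundle.carrier → c'.bundle.carrier :=
  Quot.map (fun a => ⟨a.1, a.2.1, η.toFun a.1 a.2.1 * a.2.2⟩) (by
    rintro ⟨p, u, h⟩ ⟨q, v, k⟩ ⟨f, hv, hk⟩
    dsimp only at f hv hk
    refine ⟨f, hv, ?_⟩
    dsimp only
    rw [hk, hv, ← mul_assoc, η.comm, mul_assoc])

end Cocycle

theorem IsSubduction.dSmooth {Y : Type v} [DiffeologicalSpace Y] {f : Y → X}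
    (hf : IsSubduction f) : DSmooth f := fun n r hr => by
  have h : @IsPlot _ (pushforwardDiffeology f _) n (f ∘ r) :=
    DiffeologicalSpace.isPlot_generatedFrom_of_mem ⟨r, hr, rfl⟩
  rwa [hf.2] at h

namespace DiffPrinc

/-- A smooth section of a principal bundle over a plot. -/
def plotSection (P : DiffPrinc G X) (p : Plot X) : p.dom.space → P.toBundleData.carrier :=
  (exists_section P.isPrincipalBundle p.isPlot).choose

variable (P : DiffPrinc G X)

theorem isPlot_plotSection (p : Plot X) : IsPlot (P.plotSection p) :=
  (exists_section P.isPrincipalBundle p.isPlot).choose_spec.1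

theorem proj_plotSection (p : Plot X) (u : p.dom.space) :
    P.toBundleData.proj (P.plotSection p u) = p.toFun u :=
  (exists_section P.isPrincipalBundle p.isPlot).choose_spec.2 u

theorem proj_plotSection_map {p q : Plot X} (f : p ⟶ q) (u : p.dom.space) :
    P.toBundleData.proj (P.plotSection q (f.1.1 u)) =
      P.toBundleData.proj (P.plotSection p u) := by
  rw [P.proj_plotSection, P.proj_plotSection]
  exact congrFun f.2 u

variable {P} {Q : DiffPrinc G X}

/-- A map of principal bundles over `X` is bijective, since the group acts simply transitively on
the fibres. -/
theorem Hom.bijective (F : DiffPrinc.Hom P Q) : Function.Bijective F.toFun := by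
  have hP := P.isPrincipalBundle
  have hQ := Q.isPrincipalBundle
  refine ⟨fun a b h => ?_, fun b => ?_⟩
  · have hab : P.toBundleData.proj a = P.toBundleData.proj b := by
      rw [← F.proj_comp, h, F.proj_comp]
    have e : hP.div a b = 1 := hQ.act_injective (F.toFun a) (by
      rw [← F.equivariant, hP.act_div hab, ← h, hQ.act_one])
    rw [← hP.act_div hab, e, hP.act_one]
  · obtain ⟨a, ha⟩ := hP.isSubduction.1 (Q.toBundleData.proj b)
    exact ⟨P.toBundleData.act a (hQ.div (F.toFun a) b), by
      rw [F.equivariant, hQ.act_div ((F.proj_comp a).trans ha)]⟩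

end DiffPrinc

end Bundle

section Principal

variable {G : Type u} [Group G] [DiffeologicalSpace G] [DiffeologicalGroup G]
  {X : Type u} [DiffeologicalSpace X]

namespace Cocycle

variable (c : Cocycle G X)

/-- A plot of the glued bundle with projection `p` to `X` is of the form `u ↦ [p, u, h(u)]` for a
smooth map `h`. -/
theorem exists_eq_pt_of_isPlot {n : ℕ} {r : EuclideanSpace ℝ (Fin n) → c.bundle.carrier}
    (hr : IsPlot r) :
    ∃ (hp : IsPlot (c.bundle.proj ∘ r)) (h : EuclideanSpace ℝ (Fin n) → G), IsPlot h ∧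
      ∀ u, r u = c.pt ⟨⟨n⟩, c.bundle.proj ∘ r, hp⟩ u (h u) :=
  (c.isPlot_iff_isPlotOfBundle.1 hr).eq_pt

theorem dSmooth_proj : DSmooth c.bundle.proj := fun _ _ hr =>
  (c.exists_eq_pt_of_isPlot hr).1

theorem dSmooth_act : DSmooth fun r : c.bundle.carrier × G => c.bundle.act r.1 r.2 := by
  rintro n r ⟨hr, hk⟩
  obtain ⟨hp, h, hh, e⟩ := c.exists_eq_pt_of_isPlot hr
  have e' : (fun r : c.bundle.carrier × G => c.bundle.act r.1 r.2) ∘ r = fun u =>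
      c.pt ⟨⟨n⟩, _, hp⟩ u (h u * (r u).2) :=
    funext fun u => congrArg (c.bundle.act · (r u).2) (e u)
  rw [e']
  exact c.isPlot_pt ⟨⟨n⟩, _, hp⟩ contDiff_id (hh.mul hk)

/-- The projection of the glued bundle is a subduction: a plot `p` lifts to `u ↦ [p, u, 1]`. -/
theorem isSubduction_proj : IsSubduction c.bundle.proj := by
  refine ⟨fun x => ⟨c.pt (Plot.point x) 0 1, rfl⟩, le_antisymm ?_ ?_⟩
  · refine DiffeologicalSpace.generateFrom_le_iff.2 ?_
    rintro n q ⟨r, hr, e⟩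
    have e : q = c.bundle.proj ∘ r := e
    rw [e]
    exact c.dSmooth_proj _ r hr
  · refine DiffeologicalSpace.le_iff'.2 fun n p hp => ?_
    exact DiffeologicalSpace.isPlot_generatedFrom_of_mem
      ⟨_, c.isPlot_pt ⟨⟨n⟩, p, hp⟩ contDiff_id (isPlot_const (x := 1)), rfl⟩

/-- If `a` and `b` are plots over the same plot `p` then `a = [p, u, h(u)]` and `b = [p, u, k(u)]`
with `h` and `k` smooth, so that the function with values in the group which takes `a` to `b`
is `h⁻¹k`. -/
theorem isPlot_inv_coord_mul_coord {n : ℕ} {a b : EuclideanSpace ℝ (Fin n) → c.bundle.carrier}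
    (ha : IsPlot a) (hb : IsPlot b) (h : ∀ u, c.bundle.proj (a u) = c.bundle.proj (b u)) :
    IsPlot fun u => (c.coord (a u))⁻¹ * c.coord (b u) := by
  let p : Plot X := ⟨⟨n⟩, _, c.dSmooth_proj n b hb⟩
  have h₁ := c.isPlot_pointValue_mul_coord p ha h
  have h₂ := c.isPlot_pointValue_mul_coord p hb fun _ => rfl
  have e := h₁.inv.mul h₂
  simp only [mul_inv_rev, mul_assoc, inv_mul_cancel_left] at e
  exact e

theorem isPrincipalBundle : c.bundle.IsPrincipalBundle where
  act_one := c.act_one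
  act_mul := c.act_mul
  dSmooth_act := c.dSmooth_act
  proj_act := c.proj_act
  isSubduction := c.isSubduction_proj
  isDiffeomorphism := by
    refine ⟨fun n r hr => ⟨hr.1, c.dSmooth_act n r hr⟩,
      fun r => (r.1.1, (c.coord r.1.1)⁻¹ * c.coord r.1.2), fun n r hr => ⟨hr.1, ?_⟩,
      fun r => Prod.ext rfl ?_, fun r => Subtype.ext (Prod.ext rfl ?_)⟩
    · exact c.isPlot_inv_coord_mul_coord hr.1 hr.2 fun u => (r u).2
    · change (c.coord r.1)⁻¹ * c.coord (c.bundle.act r.1 r.2) = r.2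
      rw [coord_act, inv_mul_cancel_left]
    · exact c.act_inv_coord_mul_coord r.2

/-- The principal bundle glued from a cocycle. -/
abbrev princ : DiffPrinc G X := ⟨c.bundle, c.isPrincipalBundle⟩

variable {c} {c' c'' : Cocycle G X}

namespace Hom

/-- The map of principal bundles of a map of cocycles. -/
def princHom (η : c.Hom c') : DiffPrinc.Hom c.princ c'.princ where
  toFun := η.bundleMap
  dSmooth n r hr := by
    obtain ⟨hp, h, hh, e⟩ := c.exists_eq_pt_of_isPlot hr
    rw [show r = _ from funext e]
    exact c'.isPlot_pt ⟨⟨n⟩, _, hp⟩ contDiff_id ((η.toFun ⟨⟨n⟩, _, hp⟩).2.isPlot.mul hh)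
  equivariant a g := by
    obtain ⟨p, u, h, rfl⟩ := c.exists_eq_pt a
    exact congrArg (c'.pt p u) (mul_assoc _ _ _).symm
  proj_comp a := by
    obtain ⟨p, u, h, rfl⟩ := c.exists_eq_pt a
    rfl

end Hom

variable (G X) in
/-- The functor from cocycles to principal bundles which sends a cocycle to the bundle glued from
it. -/
def glue : Cocycle G X ⥤ DiffPrinc G X where
  obj c := c.princ
  map η := Hom.princHom η
  map_id c := DiffPrinc.Hom.ext (funext fun a => by
    obtain ⟨p, u, h, rfl⟩ := c.exists_eq_pt a
    exact congrArg (c.pt p u) (one_mul h))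
  map_comp {c c' c''} η θ := DiffPrinc.Hom.ext (funext fun a => by
    obtain ⟨p, u, h, rfl⟩ := c.exists_eq_pt a
    exact congrArg (c''.pt p u) (mul_assoc _ _ _))

instance : (glue G X).Faithful where
  map_injective {c c'} η θ h := hom_ext fun p u => by
    have e : c'.pt p u (η.toFun p u * 1) = c'.pt p u (θ.toFun p u * 1) :=
      congrFun (congrArg DiffPrinc.Hom.toFun h) (c.pt p u 1)
    simpa only [mul_one] using c'.pt_injective p u e

/-- The map of cocycles of a map `F` between glued bundles: `h_p` is determined by
`F [p, u, 1] = [p, u, h_p(u)]`. -/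
def homOfBundleMap (F : DiffPrinc.Hom c.princ c'.princ) : c.Hom c' where
  toFun p := ⟨fun u => c'.pointValue p u * c'.coord (F.toFun (c.pt p u 1)),
    (c'.isPlot_pointValue_mul_coord p
      (F.dSmooth _ _ (c.isPlot_pt p contDiff_id (isPlot_const (x := 1))))
      fun u => F.proj_comp _).dSmooth⟩
  comm {p q} f u := by
    have e : c.bundle.act (c.pt q (f.1.1 u) 1) (c.toFun f u) = c.pt p u 1 := by
      rw [act_pt, c.pt_map f u, one_mul, mul_one]
    change c'.pointValue q (f.1.1 u) * c'.coord _ * c.toFun f u =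
      c'.toFun f u * (c'.pointValue p u * c'.coord _)
    rw [← e, F.equivariant, c'.coord_act, ← mul_assoc (c'.toFun f u), ← c'.pointValue_map]
    simp only [mul_assoc]

instance : (glue G X).Full where
  map_surjective {c c'} F := by
    change DiffPrinc.Hom c.princ c'.princ at F
    refine ⟨homOfBundleMap F, DiffPrinc.Hom.ext (funext fun a => ?_)⟩
    obtain ⟨p, u, h, rfl⟩ := c.exists_eq_pt a
    have e : F.toFun (c.pt p u h) = c'.bundle.act (F.toFun (c.pt p u 1)) h := by
      rw [← F.equivariant, act_pt, one_mul]
    rw [e, c'.eq_pt (F.toFun (c.pt p u 1)) p u (F.proj_comp _), act_pt]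
    rfl

end Cocycle

namespace DiffPrinc

variable {P Q : DiffPrinc G X}

/-- The inverse of a map of principal bundles. It is smooth because a plot `r` of the target is of
the form `F(σ(u)) · h(u)`, where `σ` is a smooth section of the source over the projection of `r`
and `h` is smooth, and then its image under the inverse is `σ(u) · h(u)`. -/
def Hom.symm (F : DiffPrinc.Hom P Q) : DiffPrinc.Hom Q P where
  toFun := (Equiv.ofBijective F.toFun F.bijective).symm
  dSmooth n r hr := by
    have hP := P.isPrincipalBundle
    have hQ := Q.isPrincipalBundle
    obtain ⟨σ, hσ, h⟩ := exists_section hP (hQ.isSubduction.dSmooth n r hr)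
    have hF : ∀ u, Q.toBundleData.proj (F.toFun (σ u)) = Q.toBundleData.proj (r u) := fun u =>
      (F.proj_comp _).trans (h u)
    have e : (Equiv.ofBijective F.toFun F.bijective).symm ∘ r = fun u =>
        P.toBundleData.act (σ u) (hQ.div (F.toFun (σ u)) (r u)) := funext fun u => by
      refine (Equiv.symm_apply_eq _).2 ?_
      rw [Equiv.ofBijective_apply, F.equivariant, hQ.act_div (hF u)]
    rw [e]
    exact hP.isPlot_act hσ (hQ.isPlot_div (F.dSmooth n σ hσ) hr hF)
  equivariant b g := by
    obtain ⟨a, rfl⟩ := F.bijective.2 b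
    rw [← F.equivariant]
    refine (Equiv.ofBijective_symm_apply_apply _ F.bijective _).trans ?_
    rw [Equiv.ofBijective_symm_apply_apply _ F.bijective]
  proj_comp b := by
    obtain ⟨a, rfl⟩ := F.bijective.2 b
    rw [F.proj_comp, Equiv.ofBijective_symm_apply_apply _ F.bijective]

instance : Groupoid.{u} (DiffPrinc G X) where
  inv F := Hom.symm F
  inv_comp F := Hom.ext (funext fun b => Equiv.ofBijective_apply_symm_apply _ (Hom.bijective F) b)
  comp_inv F := Hom.ext (funext fun a => Equiv.ofBijective_symm_apply_apply _ (Hom.bijective F) a)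

/-- The cocycle of a principal bundle with respect to the sections `σ_p` over the plots: it is
determined by `σ_q(f(u)) · g_f(u) = σ_p(u)`. -/
def cocycle (P : DiffPrinc G X) : Cocycle G X where
  toFun {p q} f := ⟨fun u =>
      P.isPrincipalBundle.div (P.plotSection q (f.1.1 u)) (P.plotSection p u),
    (P.isPrincipalBundle.isPlot_div (isPlot_reparam (P.isPlot_plotSection q) f.1.2)
      (P.isPlot_plotSection p) (P.proj_plotSection_map f)).dSmooth⟩
  map_comp {p q r} f f' u := by
    have hP := P.isPrincipalBundle
    refine hP.act_injective (P.plotSection r (f'.1.1 (f.1.1 u))) ?_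
    refine (hP.act_div (P.proj_plotSection_map (f ≫ f') u)).trans ?_
    refine Eq.symm ((hP.act_mul _ _ _).trans ?_)
    refine (congrArg (P.toBundleData.act · _) (hP.act_div (P.proj_plotSection_map f' _))).trans ?_
    exact hP.act_div (P.proj_plotSection_map f u)

/-- The map `[p, u, h] ↦ σ_p(u) · h` to a principal bundle from the bundle glued from its
cocycle. -/
def ofCocycle (P : DiffPrinc G X) : DiffPrinc.Hom P.cocycle.princ P where
  toFun := Quot.lift (fun a => P.toBundleData.act (P.plotSection a.1 a.2.1) a.2.2) (by
    rintro ⟨p, u, h⟩ ⟨q, v, k⟩ ⟨f, hv, hk⟩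
    have hP := P.isPrincipalBundle
    dsimp only at f hv hk ⊢
    rw [hv, hk, hP.act_mul]
    exact congrArg (P.toBundleData.act · h) (hP.act_div (P.proj_plotSection_map f u)).symm)
  dSmooth n r hr := by
    obtain ⟨hp, h, hh, e⟩ := P.cocycle.exists_eq_pt_of_isPlot hr
    rw [show r = _ from funext e]
    exact P.isPrincipalBundle.isPlot_act (P.isPlot_plotSection ⟨⟨n⟩, _, hp⟩) hh
  equivariant a g := by
    obtain ⟨p, u, h, rfl⟩ := P.cocycle.exists_eq_pt a
    exact P.isPrincipalBundle.act_mul _ _ _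
  proj_comp a := by
    obtain ⟨p, u, h, rfl⟩ := P.cocycle.exists_eq_pt a
    exact (P.isPrincipalBundle.proj_act _ _).trans (P.proj_plotSection p u)

end DiffPrinc

instance : (Cocycle.glue G X).EssSurj where
  mem_essImage P := ⟨P.cocycle, ⟨Groupoid.isoEquivHom _ _ |>.symm P.ofCocycle⟩⟩

end Principal

/-! ### The comparison map -/

section Comparison

/-- The nerve of a category `C` is presented by `C`. -/
def NerveModel.nerve (C : Type u) [Category.{v} C] : NerveModel (CategoryTheory.nerve C) C where
  equiv _ := Equiv.refl _
  equiv_map _ _ := rfl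

/-- A presentation of `Z` presents the simplicial set `Z` in a larger universe too. -/
def NerveModel.ulift {Z : SSet.{w}} {C : Type*} [Category* C] (M : NerveModel Z C) :
    NerveModel (SSet.uliftFunctor.{u, w}.obj Z) C where
  equiv n := Equiv.ulift.trans (M.equiv n)
  equiv_map c z := M.equiv_map c z.down

variable (G : Type u) [Group G] [DiffeologicalSpace G] [DiffeologicalGroup G]
  (X : Type u) [DiffeologicalSpace X]

/-- The totalization of `BG(QX)` is the nerve of the groupoid of cocycles. -/
def Tot.nerveModel : NerveModel (Tot (cosimplicialBGQ G X)) (Cocycle G X) where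
  equiv := Tot.equivCocycles
  equiv_map := Tot.toCocycles_map

/-- The map from the totalization of `BG(QX)` to the nerve of the category of principal bundles
induced by `Cocycle.glue`. -/
def Tot.toNerve : SSet.uliftFunctor.{u + 1, u}.obj (Tot (cosimplicialBGQ G X)) ⟶
    nerve (DiffPrinc G X) where
  app n := ↾fun s => Tot.toCocycles (k := n.unop) s.down ⋙ Cocycle.glue G X
  naturality n n' c := by
    ext s
    exact congrArg (· ⋙ Cocycle.glue G X) (Tot.toCocycles_map c.unop s.down)

end Comparison

end Diffeology

end

theorem mainTheorem4 (G : Type u) [Group G] [DiffeologicalSpace G] [DiffeologicalGroup G]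
    (X : Type u) [DiffeologicalSpace X] :
    SSet.KanComplex (Tot (cosimplicialBGQ G X)) ∧
    SSet.KanComplex (nerve (DiffPrinc G X)) ∧
    ∃ (hP : ∀ t : (Tot (cosimplicialBGQ G X)) _⦋0⦌,
        (gluedBundle (Tot.cocycle t)).IsPrincipalBundle)
      (φ : SSet.uliftFunctor.{u + 1, u}.obj (Tot (cosimplicialBGQ G X)) ⟶
        nerve (DiffPrinc G X)),
      (∀ t : (Tot (cosimplicialBGQ G X)) _⦋0⦌,
        φ.app (op ⦋0⦌) ⟨t⟩ =
          ComposableArrows.mk₀ (⟨gluedBundle (Tot.cocycle t), hP t⟩ : DiffPrinc G X)) ∧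
      (∀ s : (Tot (cosimplicialBGQ G X)) _⦋1⦌,
        ∃ F : (⟨_, hP ((Tot (cosimplicialBGQ G X)).δ 1 s)⟩ : DiffPrinc G X) ⟶
            ⟨_, hP ((Tot (cosimplicialBGQ G X)).δ 0 s)⟩,
          (∀ (p : Plot X) (x : p.dom.space) (k : G),
            F.toFun (gluedBundle.mk _ p x k) =
              gluedBundle.mk _ p x (Tot.cocycleMap s p x * k)) ∧
          φ.app (op ⦋1⦌) ⟨s⟩ = ComposableArrows.mk₁ F) ∧
      IsKanWeakEquivalence φ := by
  refine ⟨(Tot.nerveModel G X).kanComplex, (NerveModel.nerve (DiffPrinc G X)).kanComplex,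
    fun t => (Tot.cocycleObj t).isPrincipalBundle, Tot.toNerve G X, fun t => ?_, fun s => ?_, ?_⟩
  · exact (congrArg (· ⋙ Cocycle.glue G X) (Tot.toCocycles_zero t)).trans
      (ComposableArrows.ext₀ rfl)
  · refine ⟨(Cocycle.glue G X).map (Tot.cocycleHom s), fun _ _ _ => rfl, ?_⟩
    exact (congrArg (· ⋙ Cocycle.glue G X) (Tot.toCocycles_one s)).trans
      (ComposableArrows.ext₁ rfl rfl (by simp; rfl))
  · exact (Tot.nerveModel G X).ulift.isKanWeakEquivalence (NerveModel.nerve (DiffPrinc G X))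
      (Tot.toNerve G X) (Cocycle.glue G X) fun _ _ => rfl
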